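/- Let $n\ge 2$, let $\mathbb K$ be a topological field isomorphic to $\mathbb C$, and let $\iota_1\neq\iota_2:\mathbb K\to\mathbb C$ be its two topological isomorphisms onto $\mathbb C$. Put $G_{\mathbb C}=\mathrm{GL}_n(\mathbb C)\times \mathrm{GL}_n(\mathbb C)$ and $K=\mathrm U(n)=\{g\in\mathrm{GL}_n(\mathbb K):\iota_1(g)\,\iota_2(g)^{t}=1\}$, which maps to $G_{\mathbb C}$ by $g\mapsto(\iota_1(g),\iota_2(g))$. For a weakly decreasing $\lambda\in\mathbb Z^n$ let $E_\lambda$ be the irreducible algebraic representation of $\mathrm{GL}_n(\mathbb C)$ with highest weight $\lambda$; its restriction to $K$ (via $\iota_1$) is also denoted $E_\lambda$. For an integer $a$ let $\mathrm{Sym}^a$ be $E_{(a,0,\dots,0)}$ if $a\ge0$ and $E_{(0,\dots,0,a)}$ if $a<0$. For a pair $\lambda=(\lambda_L;\lambda_R)$ of weakly decreasing sequences in $\mathbb Z^n$ let $F_\lambda$ be the irreducible algebraic representation of $G_{\mathbb C}$ with highest weight $\lambda$, and put $\lambda_L-w_0\lambda_R=(\lambda_{L,i}-\lambda_{R,n+1-i})_{1\le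 i\le n}$. Let $\mu=(\mu_1\ge\dots\ge\mu_n;\ \mu_{n+1}\ge\dots\ge\mu_{2n})$ and $\nu=(\nu_1\ge\dots\ge\nu_n;\ \nu_{n+1}\ge\dots\ge\nu_{2n})$ be sequences of integers that are pure with weights $w$ and $w'$: $\mu_i+\mu_{2n+1-i}=w$ and $\nu_i+\nu_{2n+1-i}=w'$ for $1\le i\le n$. Put $\kappa=(w+w')/2$, $k_\eta=\sum_{i=1}^n(\mu_i+\nu_i)$, and let $M^k$ and $m^k$ be the maximum and the minimum of $\mu_i+\nu_l$ over $1\le i,l\le n$ with $i+l=k$. Assume that $\mu$ and $\nu$ are compatible, i.e. at least one of the two systems $$-m^n\le s\le -M^{n+1},\qquad 1-2\kappa+M^{n+1}\le s\le 1-2\kappa+m^n,$$ $$1-m^{n+1}\le s\le 1-M^{n+2},\qquad M^{n+2}-2\kappa\le s\le -2\kappa+m^{n+1}$$ has an integer solution $s$. Put $a_i=\mu_i+\frac{n+1-2i}2$, $b_i=w-a_i$, $c_i=\nu_i+\frac{n+1-2i}2$, $d_i=w'-c_i$, and let $\pi_\mu$ and $\pi_\nu$ be the representations of $\mathrm{GL}_n(\mathbb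 K)$ induced (normalized) from the characters $\bigotimes_i z_{ii}^{a_i}\bar z_{ii}^{b_i}$ and $\bigotimes_i z_{ii}^{c_i}\bar z_{ii}^{d_i}$ of the Borel subgroup of upper triangular matrices. With $\Gamma_{\mathbb C}(s)=2(2\pi)^{-s}\Gamma(s)$, their Rankin–Selberg $L$-functions are $$L(\pi_\mu\times\pi_\nu;s)=\prod_{i,l=1}^n\Gamma_{\mathbb C}\bigl(s+\max(a_i+c_l,\,b_i+d_l)\bigr),$$ $$L(\pi_\mu^\vee\times\pi_\nu^\vee;s)=\prod_{i,l=1}^n\Gamma_{\mathbb C}\bigl(s+\max(-a_i-c_l,\,-b_i-d_l)\bigr).$$ Let $j\in\mathbb Z$ be a critical place for $\pi_\mu\times\pi_\nu$, i.e. neither $L(\pi_\mu\times\pi_\nu;s)$ nor $L(\pi_\mu^\vee\times\pi_\nu^\vee;1-s)$ has a pole at $s=j$. Let $V_j$ be the irreducible representation of $G_{\mathbb C}$ (the semicolon separating the two factors) given by (b) $V_j=(\det^{-j}\otimes\mathrm{Sym}^{nj+k_\eta};\ \mathrm{Sym}^{nj-n-k_\eta+2n\kappa}\otimes\det^{1-j})$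 if $1-2\kappa+\frac{k_\eta}n\le j\le-\frac{k_\eta}n$, (c) $V_j=(\mathrm{Sym}^{nj+k_\eta-n}\otimes\det^{1-j};\ \det^{-j}\otimes\mathrm{Sym}^{nj+2n\kappa-k_\eta})$ if $1-\frac{k_\eta}n\le j\le-2\kappa+\frac{k_\eta}n$, and let $(\lambda_L;\lambda_R)$ be its highest weight. Put $F_\xi^\vee=F_\mu^\vee\otimes F_\nu^\vee\otimes V_j$, a representation of $G_{\mathbb C}^3$, hence of $K^3=K\times K\times K$ by restriction, and of $G_{\mathbb C}$ by restriction to the diagonal. Let $\tau_\mu=E_{\mu_L-w_0\mu_R}$, $\tau_\nu=E_{\nu_L-w_0\nu_R}$, $\sigma_j=E_{\lambda_L-w_0\lambda_R}$, where $\mu=(\mu_L;\mu_R)$ and $\nu=(\nu_L;\nu_R)$, and let $\tau_\xi^\vee=\tau_\mu^\vee\otimes\tau_\nu^\vee\otimes\sigma_j$ be the outer tensor product, a representation of $K^3$. Then $\tau_\xi^\vee$ is an irreducible representation of $K^3$ and occurs with multiplicity one in $F_\xi^\vee$, i.e. $\dim\mathrm{Hom}_{K^3}(\tau_\xi^\vee,F_\xi^\vee)=1$.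 Moreover, every nonzero element of $\mathrm{Hom}_{G_{\mathbb C}}(F_\xi^\vee,\mathbb C)$ does not vanish on $\tau_\xi^\vee\subset F_\xi^\vee$, i.e. on the image of any nonzero $K^3$-equivariant map $\tau_\xi^\vee\to F_\xi^\vee$. -/

import Mathlib

open scoped Matrix TensorProduct

noncomputable section

namespace RankinSelberg

/-- The complex general linear group `GL_n(ℂ)`. -/
abbrev GLC (n : ℕ) : Type := Matrix.GeneralLinearGroup (Fin n) ℂ

/-- The complexified group `G_ℂ = GL_n(ℂ) × GL_n(ℂ)`. -/
abbrev GC (n : ℕ) : Type := GLC n × GLC n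

/-! ### Algebraic representations and highest weights -/

/-- The coordinate functions `g ↦ g i j` and `g ↦ (det g)⁻¹` of `GL_n(ℂ)`. -/
def coordFunctions (n : ℕ) : Set (GLC n → ℂ) :=
  {f | (∃ i j : Fin n, f = fun g : GLC n => (g : Matrix (Fin n) (Fin n) ℂ) i j) ∨
    f = fun g : GLC n => (g : Matrix (Fin n) (Fin n) ℂ).det⁻¹}

/-- The algebra of regular functions on `GL_n(ℂ)`. -/
def regularGL (n : ℕ) : Subalgebra ℂ (GLC n → ℂ) :=
  Algebra.adjoin ℂ (coordFunctions n)

/-- The algebra of regular functions on `GL_n(ℂ) × GL_n(ℂ)`. -/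
def regularGC (n : ℕ) : Subalgebra ℂ (GC n → ℂ) :=
  Algebra.adjoin ℂ {f | ∃ c ∈ coordFunctions n, (f = fun g => c g.1) ∨ f = fun g => c g.2}

/-- Upper triangular invertible matrices. -/
def IsUpperTriangular {n : ℕ} (b : GLC n) : Prop :=
  ∀ i k : Fin n, k < i → (b : Matrix (Fin n) (Fin n) ℂ) i k = 0

/-- The character `b ↦ ∏ b_{ii} ^ {a_i}` of the group of upper triangular matrices. -/
def borelChar {n : ℕ} (a : Fin n → ℤ) (b : GLC n) : ℂ :=
  ∏ i, (b : Matrix (Fin n) (Fin n) ℂ) i i ^ a i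

/-- `ρ` is the irreducible algebraic representation `E_a` of `GL_n(ℂ)` with highest weight `a`. -/
structure IsIrrepGL {n : ℕ} {V : Type*} [AddCommGroup V] [Module ℂ V]
    (ρ : Representation ℂ (GLC n) V) (a : Fin n → ℤ) : Prop where
  finiteDimensional : FiniteDimensional ℂ V
  algebraic : ∀ (v : V) (l : Module.Dual ℂ V), (fun g => l (ρ g v)) ∈ regularGL n
  irreducible : ρ.IsIrreducible
  highestWeight : ∃ v : V, v ≠ 0 ∧ ∀ b : GLC n, IsUpperTriangular b → ρ b v = borelChar a b • v

/-- A pair of integer sequences `(left; right)` of length `n`: a weight of `GL_n(ℂ) × GL_n(ℂ)`. -/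
structure Weight (n : ℕ) where
  left : Fin n → ℤ
  right : Fin n → ℤ

/-- `ρ` is the irreducible algebraic representation of `GL_n(ℂ) × GL_n(ℂ)` with highest
weight `a`. -/
structure IsIrrepGC {n : ℕ} {V : Type*} [AddCommGroup V] [Module ℂ V]
    (ρ : Representation ℂ (GC n) V) (a : Weight n) : Prop where
  finiteDimensional : FiniteDimensional ℂ V
  algebraic : ∀ (v : V) (l : Module.Dual ℂ V), (fun g => l (ρ g v)) ∈ regularGC n
  irreducible : ρ.IsIrreducible
  highestWeight : ∃ v : V, v ≠ 0 ∧ ∀ b₁ b₂ : GLC n, IsUpperTriangular b₁ → IsUpperTriangular b₂ →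
    ρ (b₁, b₂) v = (borelChar a.left b₁ * borelChar a.right b₂) • v

/-! ### Pure weights, compatibility -/

namespace Weight

variable {n : ℕ}

/-- Both halves are weakly decreasing. -/
def IsDominant (μ : Weight n) : Prop := Antitone μ.left ∧ Antitone μ.right

/-- `μ_1 + μ_{2n} = μ_2 + μ_{2n-1} = ⋯ = μ_n + μ_{n+1} = w`. -/
def IsPure (μ : Weight n) (w : ℤ) : Prop := ∀ i : Fin n, μ.left i + μ.right i.rev = w

/-- The weight `left - w₀ right`, with `w₀` the longest element of the symmetric group. -/
def toKWeight (a : Weight n) : Fin n → ℤ := fun i => a.left i - a.right i.rev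

end Weight

variable {n : ℕ}

/-- The set of all `μ_i + ν_l` with `i + l = k`, where `1 ≤ i, l ≤ n`. -/
def sumSet (μ ν : Weight n) (k : ℕ) : Set ℤ :=
  {x | ∃ i l : Fin n, ((i : ℕ) + 1) + ((l : ℕ) + 1) = k ∧ x = μ.left i + ν.left l}

/-- `M^k = max {μ_i + ν_l : i + l = k, 1 ≤ i, l ≤ n}`. -/
def maxSum (μ ν : Weight n) (k : ℕ) : ℤ := sSup (sumSet μ ν k)

/-- `m^k = min {μ_i + ν_l : i + l = k, 1 ≤ i, l ≤ n}`. -/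
def minSum (μ ν : Weight n) (k : ℕ) : ℤ := sInf (sumSet μ ν k)

/-- The first system of inequalities on `j`; here `w + w' = 2κ`. -/
def CondB (μ ν : Weight n) (w w' j : ℤ) : Prop :=
  (-minSum μ ν n ≤ j ∧ j ≤ -maxSum μ ν (n + 1)) ∧
    (1 - (w + w') + maxSum μ ν (n + 1) ≤ j ∧ j ≤ 1 - (w + w') + minSum μ ν n)

/-- The second system of inequalities on `j`; here `w + w' = 2κ`. -/
def CondC (μ ν : Weight n) (w w' j : ℤ) : Prop :=
  (1 - minSum μ ν (n + 1) ≤ j ∧ j ≤ 1 - maxSum μ ν (n + 2)) ∧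
    (maxSum μ ν (n + 2) - (w + w') ≤ j ∧ j ≤ -(w + w') + minSum μ ν (n + 1))

/-- Compatibility of two weights that are pure with weights `w` and `w'`. -/
def Compatible (μ ν : Weight n) (w w' : ℤ) : Prop :=
  (∃ j, CondB μ ν w w' j) ∨ ∃ j, CondC μ ν w w' j

/-! ### Critical places -/

/-- The Langlands parameter of `π_μ = Ind_B^G (z_{11}^{a_1} z̄_{11}^{b_1} ⊗ ⋯)`: the list of the
exponents `(a_i, b_i)`, where `a_i = μ_i + (n + 1 - 2 i) / 2` (with `1 ≤ i ≤ n`) and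
`b_i = w - a_i`. -/
def lParam (μ : Weight n) (w : ℤ) (i : Fin n) : ℝ × ℝ :=
  ((μ.left i : ℝ) + ((n : ℝ) + 1 - 2 * ((i : ℕ) + 1)) / 2,
    (w : ℝ) - ((μ.left i : ℝ) + ((n : ℝ) + 1 - 2 * ((i : ℕ) + 1)) / 2))

/-- The `L`-factor of the character `z ↦ z ^ a * z̄ ^ b` of `ℂˣ`, with `p = (a, b)`, that is
`2 (2π)^{-(s + max a b)} Γ(s + max a b)`. -/
def charL (p : ℝ × ℝ) (s : ℂ) : ℂ := Complex.Gammaℂ (s + ((max p.1 p.2 : ℝ) : ℂ))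

/-- The Rankin-Selberg `L`-function of two parameters (the `L`-function of their tensor
product). -/
def pairL (P Q : Fin n → ℝ × ℝ) (s : ℂ) : ℂ := ∏ i, ∏ l, charL (P i + Q l) s

/-- `f` has a pole at `z`. -/
def HasPoleAt (f : ℂ → ℂ) (z : ℂ) : Prop := meromorphicOrderAt f z < 0

/-- The integer `s₀` is a critical place for `π_μ × π_ν`: neither `L(π_μ × π_ν; s)` nor
`L(π_μ^∨ × π_ν^∨; 1 - s)` has a pole at `s = s₀`. -/
def IsCriticalPlace (μ ν : Weight n) (w w' s₀ : ℤ) : Prop :=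
  ¬ HasPoleAt (fun s => pairL (lParam μ w) (lParam ν w') s) (s₀ : ℂ) ∧
    ¬ HasPoleAt (fun s => pairL (-lParam μ w) (-lParam ν w') (1 - s)) (s₀ : ℂ)

/-! ### The highest weight of `V_j` -/

/-- `k_η = ∑ (μ_i + ν_i)`. -/
def kEta (μ ν : Weight n) : ℤ := ∑ i, (μ.left i + ν.left i)

/-- The highest weight `(a, 0, …, 0)` (for `a ≥ 0`) or `(0, …, 0, a)` (for `a < 0`) of `Sym^a`. -/
def symWeight (a : ℤ) (i : Fin n) : ℤ :=
  if 0 ≤ a then (if (i : ℕ) = 0 then a else 0) else (if (i : ℕ) + 1 = n then a else 0)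

/-- `1 - 2κ + k_η / n ≤ j ≤ - k_η / n`. -/
def CaseB (μ ν : Weight n) (w w' j : ℤ) : Prop :=
  (1 : ℚ) - (w + w') + kEta μ ν / n ≤ j ∧ (j : ℚ) ≤ -(kEta μ ν / n)

/-- `1 - k_η / n ≤ j ≤ - 2κ + k_η / n`. -/
def CaseC (μ ν : Weight n) (w w' j : ℤ) : Prop :=
  (1 : ℚ) - kEta μ ν / n ≤ j ∧ (j : ℚ) ≤ -(w + w') + kEta μ ν / n

/-- The highest weight of
`(det^{-j} ⊗ Sym^{nj + k_η}; Sym^{nj - n - k_η + 2nκ} ⊗ det^{1-j})`. -/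
def vWeightB (μ ν : Weight n) (w w' j : ℤ) : Weight n where
  left i := -j + symWeight (n * j + kEta μ ν) i
  right i := symWeight (n * j - n - kEta μ ν + n * (w + w')) i + (1 - j)

/-- The highest weight of
`(Sym^{nj + k_η - n} ⊗ det^{1-j}; det^{-j} ⊗ Sym^{nj + 2nκ - k_η})`. -/
def vWeightC (μ ν : Weight n) (w w' j : ℤ) : Weight n where
  left i := symWeight (n * j + kEta μ ν - n) i + (1 - j)
  right i := -j + symWeight (n * j + n * (w + w') - kEta μ ν) i

/-- `a` is the highest weight `(λ_L, λ_R)` of `V_j`. -/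
def IsVWeight (μ ν : Weight n) (w w' j : ℤ) (a : Weight n) : Prop :=
  (CaseB μ ν w w' j ∧ a = vWeightB μ ν w w' j) ∨ (CaseC μ ν w w' j ∧ a = vWeightC μ ν w w' j)

/-! ### The compact group and its types -/

section Compact

variable {𝕂 : Type*} [Field 𝕂] (ι₁ ι₂ : 𝕂 ≃+* ℂ)

/-- The complexification map `GL_n(𝕂) → GL_n(ℂ) × GL_n(ℂ)`, `g ↦ (ι₁ g, ι₂ g)`. -/
def complexify (n : ℕ) : Matrix.GeneralLinearGroup (Fin n) 𝕂 →* GC n :=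
  (Matrix.GeneralLinearGroup.map (ι₁ : 𝕂 →+* ℂ)).prod
    (Matrix.GeneralLinearGroup.map (ι₂ : 𝕂 →+* ℂ))

/-- The unitary group `K = U(n) = {g ∈ GL_n(𝕂) : ι₁(g) ι₂(g)ᵗ = 1}`. -/
def unitaryK (n : ℕ) : Subgroup (Matrix.GeneralLinearGroup (Fin n) 𝕂) where
  carrier := {g | ((complexify ι₁ ι₂ n g).1 : Matrix (Fin n) (Fin n) ℂ) *
    ((complexify ι₁ ι₂ n g).2 : Matrix (Fin n) (Fin n) ℂ)ᵀ = 1}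
  one_mem' := by simp
  mul_mem' := by
    intro g h hg hh
    simp only [Set.mem_ofPred_eq, map_mul, Prod.fst_mul, Prod.snd_mul, Units.val_mul,
      Matrix.transpose_mul] at *
    rw [Matrix.mul_assoc, ← Matrix.mul_assoc _ _ (Matrix.transpose _), hh, Matrix.one_mul, hg]
  inv_mem' := by
    intro g hg
    simp only [Set.mem_ofPred_eq, map_inv, Prod.fst_inv, Prod.snd_inv] at *
    generalize (complexify ι₁ ι₂ n g).1 = x at *
    generalize (complexify ι₁ ι₂ n g).2 = y at *
    have h1 : ((x⁻¹ : GLC n) : Matrix (Fin n) (Fin n) ℂ) = (y : Matrix (Fin n) (Fin n) ℂ)ᵀ := by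
      rw [← Matrix.mul_one ((x⁻¹ : GLC n) : Matrix (Fin n) (Fin n) ℂ), ← hg, ← Matrix.mul_assoc,
        Units.inv_mul, Matrix.one_mul]
    rw [h1, ← Matrix.transpose_mul, Units.inv_mul, Matrix.transpose_one]

/-- The embedding of `K` into `G_ℂ` through the complexification map. -/
def kToGC (n : ℕ) : unitaryK ι₁ ι₂ n →* GC n :=
  (complexify ι₁ ι₂ n).comp (unitaryK ι₁ ι₂ n).subtype

/-- `τ` is the `K`-type with highest weight `a`: the restriction to `K`, embedded in `GL_n(ℂ)` by
`ι₁`, of the irreducible algebraic representation `E_a` of `GL_n(ℂ)`. -/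
def IsKType {n : ℕ} {T : Type*} [AddCommGroup T] [Module ℂ T]
    (τ : Representation ℂ (unitaryK ι₁ ι₂ n) T) (a : Fin n → ℤ) : Prop :=
  ∃ E : Representation ℂ (GLC n) T, IsIrrepGL E a ∧ ∀ k, τ k = E (kToGC ι₁ ι₂ n k).1

end Compact

/-! ### Outer tensor products -/

section Outer

variable {H : Type*} [Group H] {X Y Z : Type*} [AddCommGroup X] [Module ℂ X]
  [AddCommGroup Y] [Module ℂ Y] [AddCommGroup Z] [Module ℂ Z]

/-- The outer tensor product of three representations of `H`, a representation of `H × H × H`. -/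
def outerTensor (ρ : Representation ℂ H X) (σ : Representation ℂ H Y) (θ : Representation ℂ H Z) :
    Representation ℂ (H × H × H) (X ⊗[ℂ] (Y ⊗[ℂ] Z)) :=
  Representation.tprod (ρ.comp (MonoidHom.fst H (H × H)))
    (Representation.tprod (σ.comp ((MonoidHom.fst H H).comp (MonoidHom.snd H (H × H))))
      (θ.comp ((MonoidHom.snd H H).comp (MonoidHom.snd H (H × H)))))

/-- The diagonal embedding `H → H × H × H`. -/
def diag (H : Type*) [Group H] : H →* H × H × H :=
  (MonoidHom.id H).prod ((MonoidHom.id H).prod (MonoidHom.id H))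

/-- The map `H³ → L³` induced by a homomorphism `H → L`. -/
def cube {H L : Type*} [Group H] [Group L] (f : H →* L) : H × H × H →* L × L × L :=
  f.prodMap (f.prodMap f)

end Outer

end RankinSelberg

end

/-! Since `ι₂` is the complex conjugate of `ι₁`, the group `K` sits in `GL_n × GL_n` as the unitary
part of the twisted diagonal `g ↦ (g, g⁻ᵗ)`. Unitary matrices are Zariski dense
(`eq_zero_of_unitary`), so a statement about `K` and algebraic representations may be tested on the
whole twisted diagonal.

Multiplicity one. In the irreducible representation with highest weight `a`, take the extremal
vector `x`, an eigenvector of upper triangular matrices in the first factor and of lower triangular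
ones in the second. For upper triangular `b` the pair `(b, b⁻ᵗ)` lies in that product, so `x` is a
highest weight vector for the twisted diagonal, of weight `a_L - w₀ a_R`, and it generates a copy of
the `K`-type. The torus of the twisted diagonal has no other vectors of this weight than multiples
of `x` (`extremal_unique`), so the copy is the only one (`IsKType.exists_embedding`). Positive
definite contravariant forms, obtained by averaging over `U(n) × U(n)`, take the place of general
highest weight theory. Irreducibility and multiplicity one pass to the triple tensor product by
`isIrreducible_tensor` and `exists_tensor_factor`.

Nonvanishing. Let `φ` be an invariant functional, and evaluate it on translates of the three
extremal vectors by `(g_i, h_i)`. One half of the weight of `V_j` has the shape `(m + k, k, …, k)`;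
say it is the left one. In the left variables the value is then an eigenfunction for a Borel, an
opposite Borel and the stabilizer of a vector. Since `GL_n` has an open orbit on flags × flags ×
projective space, such an invariant function is determined by one value (`eq_zero_of_openOrbit`). So
the value splits as `A(g₁, g₂, g₃) B(h₁, h₂, h₃)` with regular nonzero `A` and `B`. On the twisted
diagonal `h_i = g_i⁻ᵗ` it remains a product of two nonzero regular functions on `GL_n³`, and it is
nonzero somewhere because those functions form a domain (`exists_twistedDiag_ne_zero`). The twisted
diagonal orbits of the extremal vectors lie in the image of the `K`-type, which gives the claim. -/

noncomputable section

namespace RankinSelberg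

/-! ### Regular functions -/

section Regular

variable {n : ℕ}

theorem coord_mem_regularGL (i j : Fin n) :
    (fun g : GLC n => (g : Matrix (Fin n) (Fin n) ℂ) i j) ∈ regularGL n :=
  Algebra.subset_adjoin (Or.inl ⟨i, j, rfl⟩)

theorem det_inv_mem_regularGL :
    (fun g : GLC n => (g : Matrix (Fin n) (Fin n) ℂ).det⁻¹) ∈ regularGL n :=
  Algebra.subset_adjoin (Or.inr rfl)

theorem comp_fst_mem_regularGC {f : GLC n → ℂ} (hf : f ∈ regularGL n) :
    (fun g : GC n => f g.1) ∈ regularGC n := by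
  refine Algebra.adjoin_induction (p := fun f _ => (fun g : GC n => f g.1) ∈ regularGC n)
    ?_ ?_ ?_ ?_ hf
  · intro x hx
    exact Algebra.subset_adjoin ⟨x, hx, Or.inl rfl⟩
  · intro r
    exact (regularGC n).algebraMap_mem r
  · intro x y _ _ hx hy
    exact (regularGC n).add_mem hx hy
  · intro x y _ _ hx hy
    exact (regularGC n).mul_mem hx hy

/-- A substitution pulls regular functions back into a subalgebra containing the coordinates. -/
theorem regularGL_comp {X : Type*} (A : Subalgebra ℂ (X → ℂ)) (θ : X → GLC n)
    (hc : ∀ i j, (fun x => (θ x : Matrix (Fin n) (Fin n) ℂ) i j) ∈ A)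
    (hd : (fun x => (θ x : Matrix (Fin n) (Fin n) ℂ).det⁻¹) ∈ A)
    {f : GLC n → ℂ} (hf : f ∈ regularGL n) : (fun x => f (θ x)) ∈ A := by
  refine Algebra.adjoin_induction (p := fun f _ => (fun x => f (θ x)) ∈ A) ?_ ?_ ?_ ?_ hf
  · rintro x (⟨i, j, rfl⟩ | rfl)
    · exact hc i j
    · exact hd
  · intro r
    exact A.algebraMap_mem r
  · intro x y _ _ hx hy
    exact A.add_mem hx hy
  · intro x y _ _ hx hy
    exact A.mul_mem hx hy

theorem regularGC_comp {X : Type*} (A : Subalgebra ℂ (X → ℂ)) (θ : X → GC n)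
    (h₁ : ∀ f ∈ regularGL n, (fun x => f (θ x).1) ∈ A)
    (h₂ : ∀ f ∈ regularGL n, (fun x => f (θ x).2) ∈ A)
    {f : GC n → ℂ} (hf : f ∈ regularGC n) : (fun x => f (θ x)) ∈ A := by
  refine Algebra.adjoin_induction (p := fun f _ => (fun x => f (θ x)) ∈ A) ?_ ?_ ?_ ?_ hf
  · rintro x ⟨c, hc, (rfl | rfl)⟩
    · exact h₁ c (Algebra.subset_adjoin hc)
    · exact h₂ c (Algebra.subset_adjoin hc)
  · intro r
    exact A.algebraMap_mem r
  · intro x y _ _ hx hy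
    exact A.add_mem hx hy
  · intro x y _ _ hx hy
    exact A.mul_mem hx hy

/-- The complex conjugate of a subalgebra of functions. -/
def conjSubalgebra {X : Type*} (A : Subalgebra ℂ (X → ℂ)) : Subalgebra ℂ (X → ℂ) where
  carrier := {f | (fun x => star (f x)) ∈ A}
  mul_mem' {f g} hf hg := by
    simp only [Set.mem_ofPred_eq, Pi.mul_apply, star_mul'] at *
    exact A.mul_mem hf hg
  add_mem' {f g} hf hg := by
    simp only [Set.mem_ofPred_eq, Pi.add_apply, star_add] at *
    exact A.add_mem hf hg
  algebraMap_mem' r := A.algebraMap_mem (star r)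

/-- The subalgebra of continuous functions. -/
def contSubalgebra (X : Type*) [TopologicalSpace X] : Subalgebra ℂ (X → ℂ) where
  carrier := {f | Continuous f}
  mul_mem' {f g} hf hg := by
    simp only [Set.mem_ofPred_eq] at *
    exact hf.mul hg
  add_mem' {f g} hf hg := by
    simp only [Set.mem_ofPred_eq] at *
    exact hf.add hg
  algebraMap_mem' r := continuous_const

/-- The subalgebra of entire functions. -/
def entireSubalgebra : Subalgebra ℂ (ℂ → ℂ) where
  carrier := {f | Differentiable ℂ f}
  mul_mem' {f g} hf hg := by
    simp only [Set.mem_ofPred_eq] at *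
    exact hf.mul hg
  add_mem' {f g} hf hg := by
    simp only [Set.mem_ofPred_eq] at *
    exact hf.add hg
  algebraMap_mem' r := differentiable_const _

/-- The Leibniz formula. The subalgebra and the index type are arbitrary so that it covers
continuous, entire and polynomial entries, and also minors. -/
theorem det_mem_of_coord {X : Type*} {m : Type*} [Fintype m] [DecidableEq m]
    (A : Subalgebra ℂ (X → ℂ)) (θ : X → Matrix m m ℂ)
    (h : ∀ i j, (fun x => θ x i j) ∈ A) : (fun x => (θ x).det) ∈ A := by
  have : (fun x => (θ x).det) = ∑ σ : Equiv.Perm m,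
      (algebraMap ℂ (X → ℂ) ((Equiv.Perm.sign σ : ℤ) : ℂ)) *
        ∏ i, (fun x => θ x (σ i) i) := by
    funext x
    simp [Matrix.det_apply, Finset.sum_apply, Units.smul_def]
  rw [this]
  exact A.sum_mem fun σ _ => A.mul_mem (A.algebraMap_mem _) (A.prod_mem fun i _ => h _ _)

theorem mul_right_mem_regularGL (h : GLC n) {f : GLC n → ℂ} (hf : f ∈ regularGL n) :
    (fun g => f (g * h)) ∈ regularGL n := by
  refine regularGL_comp _ _ (fun i j => ?_) ?_ hf
  · have : (fun g : GLC n => ((g * h : GLC n) : Matrix (Fin n) (Fin n) ℂ) i j) =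
        ∑ k, (h : Matrix (Fin n) (Fin n) ℂ) k j •
          fun g : GLC n => (g : Matrix (Fin n) (Fin n) ℂ) i k := by
      funext g
      simp [Matrix.mul_apply, mul_comm]
    rw [this]
    exact Subalgebra.sum_mem _ fun k _ => Subalgebra.smul_mem _ (coord_mem_regularGL _ _) _
  · have : (fun g : GLC n => ((g * h : GLC n) : Matrix (Fin n) (Fin n) ℂ).det⁻¹) =
        (h : Matrix (Fin n) (Fin n) ℂ).det⁻¹ •
          fun g : GLC n => (g : Matrix (Fin n) (Fin n) ℂ).det⁻¹ := by
      funext g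
      simp
    rw [this]
    exact Subalgebra.smul_mem _ det_inv_mem_regularGL _

theorem inv_coord_mem_regularGL (i j : Fin n) :
    (fun g : GLC n => ((g⁻¹ : GLC n) : Matrix (Fin n) (Fin n) ℂ) i j) ∈ regularGL n := by
  have : (fun g : GLC n => ((g⁻¹ : GLC n) : Matrix (Fin n) (Fin n) ℂ) i j) =
      (fun g : GLC n => (g : Matrix (Fin n) (Fin n) ℂ).det⁻¹) *
        fun g : GLC n => ((g : Matrix (Fin n) (Fin n) ℂ).updateRow j (Pi.single i 1)).det := by
    funext g
    simp [Matrix.inv_def, Matrix.adjugate_apply]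
  rw [this]
  refine Subalgebra.mul_mem _ det_inv_mem_regularGL (det_mem_of_coord _ _ fun k l => ?_)
  by_cases h : k = j
  · subst h
    simp only [Matrix.updateRow_self]
    exact (regularGL n).algebraMap_mem _
  · simp only [Matrix.updateRow_ne h]
    exact coord_mem_regularGL _ _

theorem det_mem_regularGL :
    (fun g : GLC n => (g : Matrix (Fin n) (Fin n) ℂ).det) ∈ regularGL n :=
  det_mem_of_coord _ _ coord_mem_regularGL

theorem inv_mem_regularGL {f : GLC n → ℂ} (hf : f ∈ regularGL n) :
    (fun g => f g⁻¹) ∈ regularGL n := by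
  refine regularGL_comp _ _ inv_coord_mem_regularGL ?_ hf
  convert det_mem_regularGL (n := n) using 2 with g
  simp [Matrix.det_nonsing_inv]

/-- The involution `g ↦ (gᵗ)⁻¹` of `GL_n(ℂ)`. -/
def invTranspose : GLC n →* GLC n where
  toFun g := ⟨((g⁻¹ : GLC n) : Matrix (Fin n) (Fin n) ℂ)ᵀ, (g : Matrix (Fin n) (Fin n) ℂ)ᵀ,
    by rw [← Matrix.transpose_mul, Units.mul_inv, Matrix.transpose_one],
    by rw [← Matrix.transpose_mul, Units.inv_mul, Matrix.transpose_one]⟩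
  map_one' := by apply Units.ext; simp
  map_mul' g h := by
    apply Units.ext
    simp only [mul_inv_rev, Units.val_mul, Matrix.transpose_mul]

@[simp] theorem coe_invTranspose (g : GLC n) : (invTranspose g : Matrix (Fin n) (Fin n) ℂ) =
    ((g⁻¹ : GLC n) : Matrix (Fin n) (Fin n) ℂ)ᵀ := rfl

theorem invTranspose_invTranspose (g : GLC n) : invTranspose (invTranspose g) = g := by
  apply Units.ext
  rw [coe_invTranspose, ← map_inv, coe_invTranspose, inv_inv, Matrix.transpose_transpose]

theorem invTranspose_mem_regularGL {f : GLC n → ℂ} (hf : f ∈ regularGL n) :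
    (fun g => f (invTranspose g)) ∈ regularGL n := by
  refine regularGL_comp _ _ (fun i j => inv_coord_mem_regularGL j i) ?_ hf
  convert det_mem_regularGL (n := n) using 2 with g
  simp [Matrix.det_nonsing_inv]

theorem conjTranspose_mem_regularGL {f : GLC n → ℂ} (hf : f ∈ regularGL n) :
    (fun g => star (f (star g))) ∈ regularGL n := by
  refine regularGL_comp (conjSubalgebra (regularGL n)) (fun g => star g) (fun i j => ?_) ?_ hf
  · change (fun g : GLC n => star (((star g : GLC n) : Matrix (Fin n) (Fin n) ℂ) i j)) ∈ regularGL n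
    convert coord_mem_regularGL (n := n) j i using 2 with g
    simp [Units.coe_star, Matrix.star_apply]
  · change (fun g : GLC n => star (((star g : GLC n) : Matrix (Fin n) (Fin n) ℂ).det⁻¹)) ∈ regularGL n
    convert det_inv_mem_regularGL (n := n) using 2 with g
    simp [Units.coe_star, Matrix.star_eq_conjTranspose, Matrix.det_conjTranspose]

/-- The embedding `g ↦ (g, (gᵗ)⁻¹)`, which complexifies `U(n) → GL_n(ℂ) × GL_n(ℂ)`. -/
def twistedDiag (n : ℕ) : GLC n →* GC n := (MonoidHom.id _).prod invTranspose

theorem twistedDiag_mem_regularGL {f : GC n → ℂ} (hf : f ∈ regularGC n) :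
    (fun g => f (twistedDiag n g)) ∈ regularGL n :=
  regularGC_comp _ _ (fun _ h => h) (fun _ h => invTranspose_mem_regularGL h) hf

theorem left_mem_regularGL {f : GC n → ℂ} (hf : f ∈ regularGC n) (h : GLC n) :
    (fun g => f (g, h)) ∈ regularGL n :=
  regularGC_comp _ (fun g => (g, h)) (fun _ h => h)
    (fun f _ => (regularGL n).algebraMap_mem (f h)) hf

theorem right_mem_regularGL {f : GC n → ℂ} (hf : f ∈ regularGC n) (h : GLC n) :
    (fun g => f (h, g)) ∈ regularGL n :=
  regularGC_comp _ (fun g => (h, g)) (fun f _ => (regularGL n).algebraMap_mem (f h))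
    (fun _ h => h) hf

theorem snd_mem_regularGC {f : GLC n → ℂ} (hf : f ∈ regularGL n) :
    (fun g : GC n => f g.2) ∈ regularGC n :=
  regularGL_comp (regularGC n) (fun g : GC n => g.2)
    (fun i j => Algebra.subset_adjoin ⟨_, Or.inl ⟨i, j, rfl⟩, Or.inr rfl⟩)
    (Algebra.subset_adjoin ⟨_, Or.inr rfl, Or.inr rfl⟩) hf

theorem inv_mem_regularGC {f : GC n → ℂ} (hf : f ∈ regularGC n) :
    (fun g => f g⁻¹) ∈ regularGC n :=
  regularGC_comp (regularGC n) (fun g => g⁻¹)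
    (fun _ h => comp_fst_mem_regularGC (inv_mem_regularGL h))
    (fun _ h => snd_mem_regularGC (inv_mem_regularGL h)) hf

theorem conjTranspose_mem_regularGC {f : GC n → ℂ} (hf : f ∈ regularGC n) :
    (fun g => star (f (star g))) ∈ regularGC n :=
  regularGC_comp (conjSubalgebra (regularGC n)) (fun g => star g)
    (fun _ h => comp_fst_mem_regularGC (conjTranspose_mem_regularGL h))
    (fun _ h => snd_mem_regularGC (conjTranspose_mem_regularGL h)) hf

theorem continuous_regularGL {X : Type*} [TopologicalSpace X] (θ : X → GLC n)
    (hθ : ∀ i j, Continuous fun x => (θ x : Matrix (Fin n) (Fin n) ℂ) i j)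
    {f : GLC n → ℂ} (hf : f ∈ regularGL n) : Continuous fun x => f (θ x) := by
  refine regularGL_comp (contSubalgebra X) θ hθ ?_ hf
  have : Continuous fun x => (θ x : Matrix (Fin n) (Fin n) ℂ).det :=
    det_mem_of_coord (contSubalgebra X) _ hθ
  exact this.inv₀ fun x => (Matrix.isUnits_det_units (θ x)).ne_zero

theorem continuous_regularGC {X : Type*} [TopologicalSpace X] (θ : X → GC n)
    (h₁ : ∀ i j, Continuous fun x => ((θ x).1 : Matrix (Fin n) (Fin n) ℂ) i j)
    (h₂ : ∀ i j, Continuous fun x => ((θ x).2 : Matrix (Fin n) (Fin n) ℂ) i j)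
    {f : GC n → ℂ} (hf : f ∈ regularGC n) : Continuous fun x => f (θ x) :=
  regularGC_comp (contSubalgebra X) θ (fun _ h => continuous_regularGL _ h₁ h)
    (fun _ h => continuous_regularGL _ h₂ h) hf

theorem differentiable_regularGL (θ : ℂ → GLC n)
    (hθ : ∀ i j, Differentiable ℂ fun x => (θ x : Matrix (Fin n) (Fin n) ℂ) i j)
    {f : GLC n → ℂ} (hf : f ∈ regularGL n) : Differentiable ℂ fun x => f (θ x) := by
  refine regularGL_comp entireSubalgebra θ hθ ?_ hf
  have : Differentiable ℂ fun x => (θ x : Matrix (Fin n) (Fin n) ℂ).det :=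
    det_mem_of_coord entireSubalgebra _ hθ
  exact this.inv fun x => (Matrix.isUnits_det_units (θ x)).ne_zero

/-! ### Restriction to lines -/

theorem exists_det_polynomial {m : Type*} [Fintype m] [DecidableEq m] (A B : Matrix m m ℂ) :
    ∃ p : Polynomial ℂ, ∀ t : ℂ, p.eval t = (A + t • B).det := by
  let S : Subalgebra ℂ (ℂ → ℂ) :=
    (Polynomial.aeval (fun t : ℂ => t) : Polynomial ℂ →ₐ[ℂ] (ℂ → ℂ)).range
  obtain ⟨p, hp⟩ : (fun t : ℂ => (A + t • B).det) ∈ S := by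
    refine det_mem_of_coord S _ fun i j =>
      ⟨Polynomial.C (A i j) + Polynomial.X * Polynomial.C (B i j), ?_⟩
    funext t
    simp
    ring
  refine ⟨p, fun t => ?_⟩
  rw [← congrFun hp t]
  simp [Polynomial.aeval_fn_apply]

/-- A power of the determinant clears the denominators, with one exponent for the whole line. The
Zariski density arguments below reduce to counting roots of the resulting polynomial. -/
theorem regularGL_line {f : GLC n → ℂ} (hf : f ∈ regularGL n) (A B : Matrix (Fin n) (Fin n) ℂ) :
    ∃ (N : ℕ) (p : Polynomial ℂ), ∀ (t : ℂ) (g : GLC n),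
      (g : Matrix (Fin n) (Fin n) ℂ) = A + t • B →
        (g : Matrix (Fin n) (Fin n) ℂ).det ^ N * f g = p.eval t := by
  obtain ⟨d, hd⟩ := exists_det_polynomial A B
  refine Algebra.adjoin_induction (p := fun f _ => ∃ (N : ℕ) (p : Polynomial ℂ),
    ∀ (t : ℂ) (g : GLC n), (g : Matrix (Fin n) (Fin n) ℂ) = A + t • B →
        (g : Matrix (Fin n) (Fin n) ℂ).det ^ N * f g = p.eval t) ?_ ?_ ?_ ?_ hf
  · rintro x (⟨i, j, rfl⟩ | rfl)
    · refine ⟨0, Polynomial.C (A i j) + Polynomial.X * Polynomial.C (B i j), fun t g h => ?_⟩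
      simp [h]
      ring
    · refine ⟨1, 1, fun t g h => ?_⟩
      have := (Matrix.isUnits_det_units g).ne_zero
      simp [this]
  · intro r
    exact ⟨0, Polynomial.C r, fun t g h => by simp⟩
  · rintro x y _ _ ⟨N, p, hp⟩ ⟨N', p', hp'⟩
    refine ⟨N + N', d ^ N' * p + d ^ N * p', fun t g h => ?_⟩
    simp only [Polynomial.eval_add, Polynomial.eval_mul, Polynomial.eval_pow, ← hp t g h,
      ← hp' t g h, hd, ← h, Pi.add_apply]
    ring
  · rintro x y _ _ ⟨N, p, hp⟩ ⟨N', p', hp'⟩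
    refine ⟨N + N', p * p', fun t g h => ?_⟩
    simp only [Polynomial.eval_mul, ← hp t g h, ← hp' t g h, Pi.mul_apply]
    ring

theorem regularGL_line_finite {f : GLC n → ℂ} (hf : f ∈ regularGL n)
    (A B : Matrix (Fin n) (Fin n) ℂ) {t₀ : ℂ} {g₀ : GLC n}
    (h₀ : (g₀ : Matrix (Fin n) (Fin n) ℂ) = A + t₀ • B) (hf₀ : f g₀ ≠ 0) :
    {t : ℂ | ∃ g : GLC n, (g : Matrix (Fin n) (Fin n) ℂ) = A + t • B ∧ f g = 0}.Finite := by
  obtain ⟨N, p, hp⟩ := regularGL_line hf A B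
  have hp0 : p ≠ 0 := by
    rintro rfl
    have := hp t₀ g₀ h₀
    simp [hf₀, (Matrix.isUnits_det_units g₀).ne_zero] at this
  refine (Polynomial.rootSet_finite p ℂ).subset ?_
  rintro t ⟨g, hg, hfg⟩
  rw [Polynomial.mem_rootSet]
  refine ⟨hp0, ?_⟩
  simpa [hfg] using (hp t g hg).symm

theorem det_line_finite {m : Type*} [Fintype m] [DecidableEq m] (A B : Matrix m m ℂ) {t₀ : ℂ}
    (h : (A + t₀ • B).det ≠ 0) : {t : ℂ | (A + t • B).det = 0}.Finite := by
  obtain ⟨p, hp⟩ := exists_det_polynomial A B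
  have hp0 : p ≠ 0 := by
    rintro rfl
    exact h (by rw [← hp]; simp)
  refine (Polynomial.rootSet_finite p ℂ).subset ?_
  intro t ht
  rw [Polynomial.mem_rootSet]
  exact ⟨hp0, by simpa [hp] using ht⟩

/-- Regular functions on `GL_n(ℂ)` form a domain. -/
theorem exists_both_ne_zero {f₁ f₂ : GLC n → ℂ} (h₁ : f₁ ∈ regularGL n) (h₂ : f₂ ∈ regularGL n)
    {a b : GLC n} (ha : f₁ a ≠ 0) (hb : f₂ b ≠ 0) : ∃ g, f₁ g ≠ 0 ∧ f₂ g ≠ 0 := by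
  -- On the line from `a` to `b` each of the two functions, and the determinant, is nonzero at an
  -- endpoint, hence vanishes for finitely many parameters only.
  let A : Matrix (Fin n) (Fin n) ℂ := a.val
  let B : Matrix (Fin n) (Fin n) ℂ := b.val - a.val
  have e0 : (a : Matrix (Fin n) (Fin n) ℂ) = A + (0 : ℂ) • B := by simp [A]
  have e1 : (b : Matrix (Fin n) (Fin n) ℂ) = A + (1 : ℂ) • B := by simp [A, B]
  have f1 := regularGL_line_finite h₁ A B e0 ha
  have f2 := regularGL_line_finite h₂ A B e1 hb
  have f3 := det_line_finite A B (t₀ := 0) (by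
    rw [← e0]; exact (Matrix.isUnits_det_units a).ne_zero)
  obtain ⟨t, ht⟩ := ((f1.union f2).union f3).exists_notMem
  simp only [Set.mem_union, not_or, Set.mem_ofPred_eq, not_exists, not_and] at ht
  obtain ⟨⟨q1, q2⟩, q3⟩ := ht
  let g := Matrix.GeneralLinearGroup.mkOfDetNeZero _ q3
  exact ⟨g, q1 g rfl, q2 g rfl⟩

end Regular

section Density

variable {n : ℕ}

/-! ### Triangular matrices and the big cell -/

/-- Lower triangular invertible matrices. -/
def IsLowerTriangular (b : GLC n) : Prop :=
  ∀ i k : Fin n, i < k → (b : Matrix (Fin n) (Fin n) ℂ) i k = 0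

theorem IsUpperTriangular.inv {b : GLC n} (hb : IsUpperTriangular b) : IsUpperTriangular b⁻¹ := by
  have h : Matrix.BlockTriangular (b : Matrix (Fin n) (Fin n) ℂ) id := fun i k hik => hb i k hik
  have : Invertible (b : Matrix (Fin n) (Fin n) ℂ) := b.invertible
  have := Matrix.blockTriangular_inv_of_blockTriangular h
  intro i k hik
  rw [Matrix.coe_units_inv]
  exact this hik

theorem IsLowerTriangular.inv {b : GLC n} (hb : IsLowerTriangular b) : IsLowerTriangular b⁻¹ := by
  have h : Matrix.BlockTriangular (b : Matrix (Fin n) (Fin n) ℂ) OrderDual.toDual :=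
    fun i k hik => hb i k hik
  have : Invertible (b : Matrix (Fin n) (Fin n) ℂ) := b.invertible
  have := Matrix.blockTriangular_inv_of_blockTriangular h
  intro i k hik
  rw [Matrix.coe_units_inv]
  exact this hik

theorem IsUpperTriangular.invTranspose {b : GLC n} (hb : IsUpperTriangular b) :
    IsLowerTriangular (invTranspose b) := fun i k hik => hb.inv k i hik

theorem IsLowerTriangular.star {b : GLC n} (hb : IsLowerTriangular b) :
    IsUpperTriangular (star b) := fun i k hik => by
  rw [Units.coe_star, Matrix.star_apply, hb k i hik, star_zero]

/-- Gaussian elimination: row `i` of a unipotent `l` must kill the entries of `M` to the left of the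
diagonal, a linear system whose matrix is the leading block of size `i`. -/
theorem exists_lower_mul_upper (M : GLC n)
    (hM : ∀ i : Fin n, ((M : Matrix (Fin n) (Fin n) ℂ).toSquareBlockProp (· < i)).det ≠ 0) :
    ∃ l : GLC n, IsLowerTriangular l ∧ IsUpperTriangular (l * M) := by
  have key : ∀ i : Fin n, ∃ y : {j // j < i} → ℂ, ∀ k : {j // j < i},
      ∑ j, y j * (M : Matrix (Fin n) (Fin n) ℂ) j k = -(M : Matrix (Fin n) (Fin n) ℂ) i k := by
    intro i
    set N := (M : Matrix (Fin n) (Fin n) ℂ).toSquareBlockProp (· < i) with hN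
    refine ⟨(fun k : {j // j < i} => -(M : Matrix (Fin n) (Fin n) ℂ) i k) ᵥ* N⁻¹, fun k => ?_⟩
    have h : ((fun k : {j // j < i} => -(M : Matrix (Fin n) (Fin n) ℂ) i k) ᵥ* N⁻¹) ᵥ* N =
        fun k : {j // j < i} => -(M : Matrix (Fin n) (Fin n) ℂ) i k := by
      rw [Matrix.vecMul_vecMul, Matrix.nonsing_inv_mul _ (isUnit_iff_ne_zero.mpr (hM i)),
        Matrix.vecMul_one]
    exact congrFun h k
  choose y hy using key
  let L : Matrix (Fin n) (Fin n) ℂ := Matrix.of fun i j =>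
    if h : j < i then y i ⟨j, h⟩ else if j = i then 1 else 0
  have hLt : L.BlockTriangular OrderDual.toDual := by
    intro i j hij
    have hij' : i < j := hij
    simp [L, not_lt.mpr hij'.le, hij'.ne']
  have hL1 : L.det = 1 := by
    rw [Matrix.det_of_isLowerTriangular L hLt]
    simp [L]
  let l : GLC n := Matrix.GeneralLinearGroup.mkOfDetNeZero L (by rw [hL1]; exact one_ne_zero)
  refine ⟨l, fun i k hik => hLt hik, fun i k hki => ?_⟩
  have hrow : ∀ j, L i j * (M : Matrix (Fin n) (Fin n) ℂ) j k =
      (if h : j < i then y i ⟨j, h⟩ * (M : Matrix (Fin n) (Fin n) ℂ) j k else 0) +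
        if j = i then (M : Matrix (Fin n) (Fin n) ℂ) j k else 0 := by
    intro j
    rcases lt_trichotomy j i with h | h | h
    · simp [L, h, h.ne]
    · simp [L, h]
    · simp [L, not_lt.mpr h.le, h.ne']
  have hsum : ∑ j, (if h : j < i then y i ⟨j, h⟩ * (M : Matrix (Fin n) (Fin n) ℂ) j k else 0) =
      ∑ j : {j // j < i}, y i j * (M : Matrix (Fin n) (Fin n) ℂ) j k := by
    rw [Finset.sum_dite]
    simp only [Finset.sum_const_zero, add_zero]
    refine Finset.sum_bij' (fun x _ => ⟨x.1, (Finset.mem_filter.mp x.2).2⟩)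
      (fun x _ => ⟨x.1, by simp [x.2]⟩) ?_ ?_ ?_ ?_ ?_ <;> simp
  change (L * (M : Matrix (Fin n) (Fin n) ℂ)) i k = 0
  rw [Matrix.mul_apply, Finset.sum_congr rfl fun j _ => hrow j, Finset.sum_add_distrib, hsum,
    hy i ⟨k, hki⟩]
  simp

/-- The products of lower and upper triangular matrices are Zariski dense. -/
theorem eq_zero_of_bigCell {f : GLC n → ℂ} (hf : f ∈ regularGL n)
    (h : ∀ l b : GLC n, IsLowerTriangular l → IsUpperTriangular b → f (l * b) = 0) (g : GLC n) :
    f g = 0 := by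
  by_contra hg
  -- On the line from `1` to `g` all leading minors equal `1` at parameter `0`, so all but finitely
  -- many points lie in the big cell.
  let A : Matrix (Fin n) (Fin n) ℂ := 1
  let B : Matrix (Fin n) (Fin n) ℂ := g.val - 1
  have e1 : (g : Matrix (Fin n) (Fin n) ℂ) = A + (1 : ℂ) • B := by simp [A, B]
  have f1 := regularGL_line_finite hf A B e1 hg
  have f2 := det_line_finite A B (t₀ := 0) (by simp [A])
  have f3 : ∀ i : Fin n, {t : ℂ | ((A + t • B).toSquareBlockProp (· < i)).det = 0}.Finite := by
    intro i
    refine det_line_finite (A.toSquareBlockProp (· < i)) (B.toSquareBlockProp (· < i)) (t₀ := 0) ?_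
    have : A.toSquareBlockProp (· < i) = 1 := by
      ext j k
      simp [A, Matrix.toSquareBlockProp, Matrix.one_apply, Subtype.ext_iff]
    simp [this]
  obtain ⟨t, ht⟩ := ((f1.union f2).union (Set.finite_iUnion f3)).exists_notMem
  simp only [Set.mem_union, not_or, Set.mem_ofPred_eq, not_exists, not_and, Set.mem_iUnion] at ht
  obtain ⟨⟨q1, q2⟩, q3⟩ := ht
  let M : GLC n := Matrix.GeneralLinearGroup.mkOfDetNeZero _ q2
  obtain ⟨l, hl, hu⟩ := exists_lower_mul_upper M q3
  have := h l⁻¹ (l * M) hl.inv hu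
  rw [inv_mul_cancel_left] at this
  exact q1 M rfl this

/-! ### Density of the unitary group -/

/-- Invertible diagonal matrices. -/
def diagGL : (Fin n → ℂˣ) →* GLC n where
  toFun x := ⟨Matrix.diagonal fun i => (x i : ℂ), Matrix.diagonal fun i => ((x i)⁻¹ : ℂˣ),
    by simp, by simp⟩
  map_one' := by apply Units.ext; simp
  map_mul' x y := by apply Units.ext; simp

@[simp] theorem coe_diagGL (x : Fin n → ℂˣ) :
    (diagGL x : Matrix (Fin n) (Fin n) ℂ) = Matrix.diagonal fun i => (x i : ℂ) := rfl

theorem infinite_circle : {t : ℂ | ‖t‖ = 1}.Infinite := by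
  have : {t : ℂ | ‖t‖ = 1} = Metric.sphere (0 : ℂ) 1 := by
    ext; simp
  rw [this]
  refine (isPreconnected_sphere
    (by simp [Complex.rank_real_complex]) (0 : ℂ) 1).infinite_of_nontrivial
    ⟨1, by simp, -1, by simp, ?_⟩
  norm_num [Complex.ext_iff]

/-- The diagonal entries are released from the unit circle one at a time, `s` being the set already
released: along one entry the function is a polynomial up to a power of the determinant, and it
vanishes on the infinite circle. -/
theorem eq_zero_of_unitary_mul_diag {f : GLC n → ℂ} (hf : f ∈ regularGL n)
    (h : ∀ u : GLC n, u * star u = 1 → f u = 0) (s : Finset (Fin n)) :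
    ∀ x : Fin n → ℂˣ, (∀ i, i ∉ s → ‖(x i : ℂ)‖ = 1) →
      ∀ u : GLC n, u * star u = 1 → f (u * diagGL x) = 0 := by
  induction s using Finset.induction_on with
  | empty =>
    intro x hx u hu
    refine h _ ?_
    have : diagGL x * star (diagGL x) = 1 := by
      apply Units.ext
      simp only [Units.val_mul, Units.coe_star, coe_diagGL, Matrix.star_eq_conjTranspose,
        Matrix.diagonal_conjTranspose, Matrix.diagonal_mul_diagonal, Units.val_one]
      rw [← Matrix.diagonal_one]
      congr 1
      funext i
      have := hx i (by simp)
      simp [Complex.mul_conj, Complex.normSq_eq_norm_sq, this]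
    rw [star_mul, mul_assoc, ← mul_assoc (diagGL x), this, one_mul, hu]
  | insert i s his ih =>
    intro x hx u hu
    by_contra hne
    let A : Matrix (Fin n) (Fin n) ℂ :=
      u.val * Matrix.diagonal (Function.update (fun i => (x i : ℂ)) i 0)
    let B : Matrix (Fin n) (Fin n) ℂ := u.val * Matrix.diagonal (Pi.single i 1)
    have hline : ∀ t : ℂˣ, ((u * diagGL (Function.update x i t) : GLC n) :
        Matrix (Fin n) (Fin n) ℂ) = A + (t : ℂ) • B := by
      intro t
      simp only [A, B, Units.val_mul, coe_diagGL, ← Matrix.mul_smul, ← Matrix.mul_add,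
        ← Matrix.diagonal_smul, Matrix.diagonal_add]
      congr 2
      funext k
      by_cases hk : k = i
      · subst hk; simp
      · simp [hk]
    have e1 := hline (x i)
    rw [Function.update_eq_self] at e1
    have f1 := regularGL_line_finite hf A B e1 hne
    refine infinite_circle (f1.subset ?_)
    intro t ht
    have ht0 : t ≠ 0 := by
      rintro rfl
      simp at ht
    refine ⟨_, hline (Units.mk0 t ht0), ih _ (fun k hk => ?_) u hu⟩
    by_cases hki : k = i
    · subst hki; simpa using ht
    · rw [Function.update_of_ne hki]
      exact hx k (by simp [hki, hk])

open scoped ComplexOrder in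
/-- The unitary matrices are Zariski dense. -/
theorem eq_zero_of_unitary {f : GLC n → ℂ} (hf : f ∈ regularGL n)
    (h : ∀ u : GLC n, u * star u = 1 → f u = 0) (g : GLC n) : f g = 0 := by
  -- Polar decomposition: with `g* g = v d² v*` the matrix `g v d⁻¹` is unitary, and `g = (g v d⁻¹)
  -- d v*`.
  let H : Matrix (Fin n) (Fin n) ℂ := (g.val)ᴴ * g.val
  have hH : H.PosDef := Matrix.PosDef.conjTranspose_mul_self _
    (Matrix.mulVec_injective_iff_isUnit.mpr g.isUnit)
  let v : GLC n := Unitary.toUnits hH.1.eigenvectorUnitary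
  have hv : v * star v = 1 := by
    apply Units.ext
    exact Unitary.mul_star_self_of_mem hH.1.eigenvectorUnitary.2
  have hv' : star v * v = 1 := by
    apply Units.ext
    exact Unitary.star_mul_self_of_mem hH.1.eigenvectorUnitary.2
  have hpos := hH.eigenvalues_pos
  let x : Fin n → ℂˣ := fun i => Units.mk0 ((Real.sqrt (hH.1.eigenvalues i) : ℝ) : ℂ) (by
    have := Real.sqrt_pos.mpr (hpos i)
    exact_mod_cast this.ne')
  let d : GLC n := diagGL x
  have hd : star d = d := by
    apply Units.ext
    simp [d, x, Units.coe_star, Matrix.star_eq_conjTranspose, Matrix.diagonal_conjTranspose]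
  have hspec : star g * g = v * (d * d) * star v := by
    apply Units.ext
    have := hH.1.spectral_theorem
    rw [Unitary.conjStarAlgAut_apply] at this
    change H = _
    rw [this]
    simp only [Units.val_mul, d, coe_diagGL, Matrix.diagonal_mul_diagonal]
    congr 3
    funext i
    simp only [x, Units.val_mk0, Function.comp]
    rw [← Complex.ofReal_mul, Real.mul_self_sqrt (hpos i).le]
    rfl
  have hu : star (g * v * d⁻¹) * (g * v * d⁻¹) = 1 := by
    have : star (g * v * d⁻¹) * (g * v * d⁻¹) = star d⁻¹ * (star v * (star g * g) * v) * d⁻¹ := by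
      simp only [star_mul, mul_assoc]
    rw [this, hspec]
    have h2 : star v * (v * (d * d) * star v) * v = (star v * v) * (d * d) * (star v * v) := by
      simp only [mul_assoc]
    rw [h2, hv', star_inv, hd]
    group
  have hu' : (g * v * d⁻¹) * star (g * v * d⁻¹) = 1 := by
    rw [mul_eq_one_iff_eq_inv] at hu ⊢
    rw [hu, inv_inv]
  have := eq_zero_of_unitary_mul_diag (mul_right_mem_regularGL (star v) hf) (fun u hu => by
    refine h _ ?_
    rw [star_mul, star_star, mul_assoc, ← mul_assoc (star v), hv', one_mul, hu]) Finset.univ x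
    (by simp) _ hu'
  rwa [inv_mul_cancel_right, mul_assoc, hv, mul_one] at this

theorem eq_zero_of_unitary_prod {f : GC n → ℂ} (hf : f ∈ regularGC n)
    (h : ∀ u v : GLC n, u * star u = 1 → v * star v = 1 → f (u, v) = 0) (g : GC n) : f g = 0 :=
  eq_zero_of_unitary (right_mem_regularGL hf g.1) (fun v hv =>
    eq_zero_of_unitary (left_mem_regularGL hf v) (fun u hu => h u v hu hv) g.1) g.2

/-- The second factor has the opposite order, to match vectors that are eigenvectors for upper
triangular matrices on the left and lower triangular ones on the right; inversion reduces it to the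
usual big cell. -/
theorem eq_zero_of_bigCell_prod {f : GC n → ℂ} (hf : f ∈ regularGC n)
    (h : ∀ l₁ b₁ l₂ b₂ : GLC n, IsLowerTriangular l₁ → IsUpperTriangular b₁ →
      IsLowerTriangular l₂ → IsUpperTriangular b₂ → f (l₁ * b₁, b₂ * l₂) = 0) (g : GC n) :
    f g = 0 := by
  refine eq_zero_of_bigCell (left_mem_regularGL hf g.2) (fun l₁ b₁ hl₁ hb₁ => ?_) g.1
  have := eq_zero_of_bigCell (inv_mem_regularGL (right_mem_regularGL hf (l₁ * b₁)))
    (fun l b hl hb => ?_) g.2⁻¹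
  · simpa using this
  · rw [mul_inv_rev]
    exact h _ _ _ _ hl₁ hb₁ hl.inv hb.inv

end Density

/-! ### Contravariant Hermitian forms by averaging over the compact group -/

section ContravariantForms

/-- A positive definite Hermitian form for which the adjoint of `ρ g` is `ρ (star g)`. -/
structure ContravariantForm {G V : Type*} [Group G] [StarMul G] [AddCommGroup V] [Module ℂ V]
    (ρ : Representation ℂ G V) where
  form : V →ₗ⋆[ℂ] V →ₗ[ℂ] ℂ
  symm : ∀ x y, star (form x y) = form y x
  definite : ∀ x, form x x = 0 → x = 0
  contra : ∀ g x y, form (ρ g x) y = form x (ρ (star g) y)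

variable {n : ℕ}

instance : CompactSpace (Matrix.unitaryGroup (Fin n) ℂ) := by
  suffices h : IsCompact (Matrix.unitaryGroup (Fin n) ℂ : Set (Matrix (Fin n) (Fin n) ℂ)) from
    isCompact_iff_compactSpace.mp h
  have hc : IsCompact (Set.pi Set.univ fun _ : Fin n => Set.pi Set.univ fun _ : Fin n =>
      Metric.closedBall (0 : ℂ) 1) :=
    isCompact_univ_pi fun _ => isCompact_univ_pi fun _ => isCompact_closedBall 0 1
  have hcl : IsClosed {A : Matrix (Fin n) (Fin n) ℂ | A * star A = 1} :=
    isClosed_eq (continuous_id.mul continuous_star) continuous_const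
  refine IsCompact.of_isClosed_subset (X := Matrix (Fin n) (Fin n) ℂ) hc ?_ ?_
  · convert hcl using 1
    ext A
    exact Matrix.mem_unitaryGroup_iff
  · intro A hA i _ j _
    simpa using entry_norm_bound_of_unitary hA i j

/-- The inclusion of `U(n) × U(n)` in `GL_n(ℂ) × GL_n(ℂ)`. -/
def unitaryProd (n : ℕ) :
    Matrix.unitaryGroup (Fin n) ℂ × Matrix.unitaryGroup (Fin n) ℂ →* GC n :=
  Unitary.toUnits.prodMap Unitary.toUnits

theorem continuous_unitaryProd_inv {f : GC n → ℂ} (hf : f ∈ regularGC n) :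
    Continuous fun k => f (unitaryProd n k)⁻¹ := by
  have h : ∀ i j, Continuous fun u : Matrix.unitaryGroup (Fin n) ℂ =>
      ((Unitary.toUnits u⁻¹ : GLC n) : Matrix (Fin n) (Fin n) ℂ) i j := fun i j =>
    (continuous_apply j).comp ((continuous_apply i).comp
      (continuous_subtype_val.comp (continuous_inv (G := Matrix.unitaryGroup (Fin n) ℂ))))
  refine continuous_regularGC (fun k => (unitaryProd n k)⁻¹) (fun i j => ?_) (fun i j => ?_) hf
  · simp only [← map_inv]
    exact (h i j).comp continuous_fst
  · simp only [← map_inv]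
    exact (h i j).comp continuous_snd

-- Weyl's unitary trick: average the standard Hermitian form of a basis over Haar measure.
open MeasureTheory in
theorem exists_unitary_invariant_form {V : Type*} [AddCommGroup V] [Module ℂ V]
    [FiniteDimensional ℂ V] (ρ : Representation ℂ (GC n) V)
    (halg : ∀ (v : V) (l : Module.Dual ℂ V), (fun g => l (ρ g v)) ∈ regularGC n) :
    ∃ form : V →ₗ⋆[ℂ] V →ₗ[ℂ] ℂ, (∀ x y, star (form x y) = form y x) ∧
      (∀ x, form x x = 0 → x = 0) ∧
      ∀ k x y, form (ρ (unitaryProd n k) x) (ρ (unitaryProd n k) y) = form x y := by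
  let K := Matrix.unitaryGroup (Fin n) ℂ × Matrix.unitaryGroup (Fin n) ℂ
  let _ : MeasurableSpace K := borel K
  have : BorelSpace K := ⟨rfl⟩
  let m : Measure K := Measure.haar
  let b := Module.finBasis ℂ V
  -- The inverse of `k` is used so that left invariance of Haar measure yields invariance of the
  -- form.
  let φ : V → V → K → ℂ := fun x y k => ∑ i,
    star (b.coord i (ρ (unitaryProd n k)⁻¹ x)) * b.coord i (ρ (unitaryProd n k)⁻¹ y)
  have hcont : ∀ x y, Continuous (φ x y) := fun x y => by
    refine continuous_finsetSum _ fun i _ => ?_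
    exact (continuous_star.comp (continuous_unitaryProd_inv (halg x (b.coord i)))).mul
      (continuous_unitaryProd_inv (halg y (b.coord i)))
  have hint : ∀ x y, Integrable (φ x y) m := fun x y =>
    (hcont x y).integrable_of_hasCompactSupport (HasCompactSupport.of_compactSpace _)
  let form : V →ₗ⋆[ℂ] V →ₗ[ℂ] ℂ := LinearMap.mk₂'ₛₗ (starRingEnd ℂ) (RingHom.id ℂ)
    (fun x y => ∫ k, φ x y k ∂m)
    (fun x x' y => by
      rw [← integral_add (hint _ _) (hint _ _)]
      congr 1; funext k
      simp only [φ, map_add, star_add, add_mul, Finset.sum_add_distrib])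
    (fun c x y => by
      rw [smul_eq_mul, ← integral_const_mul]
      congr 1; funext k
      simp only [φ, map_smul, smul_eq_mul, star_mul', Finset.mul_sum, mul_assoc]
      rfl)
    (fun x y y' => by
      rw [← integral_add (hint _ _) (hint _ _)]
      congr 1; funext k
      simp only [φ, map_add, mul_add, Finset.sum_add_distrib])
    (fun c x y => by
      rw [smul_eq_mul, ← integral_const_mul]
      congr 1; funext k
      simp only [φ, map_smul, smul_eq_mul, Finset.mul_sum, RingHom.id_apply]
      exact Finset.sum_congr rfl fun i _ => by ring)
  have hform : ∀ x y, form x y = ∫ k, φ x y k ∂m := fun x y => rfl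
  refine ⟨form, fun x y => ?_, fun x hx => ?_, fun h x y => ?_⟩
  · rw [hform, hform]
    change (starRingEnd ℂ) _ = _
    rw [← integral_conj]
    congr 1; funext k
    simp only [φ, map_sum, map_mul]
    exact Finset.sum_congr rfl fun i _ => by
      rw [mul_comm]
      simp
  · by_contra hx0
    let ψ : K → ℝ := fun k => ∑ i, ‖b.coord i (ρ (unitaryProd n k)⁻¹ x)‖ ^ 2
    have hφψ : ∀ k, φ x x k = (ψ k : ℂ) := fun k => by
      simp only [φ, ψ, Complex.ofReal_sum]
      exact Finset.sum_congr rfl fun i _ => by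
        rw [Complex.ofReal_pow]
        exact Complex.conj_mul' _
    have hψc : Continuous ψ := by
      refine continuous_finsetSum _ fun i _ => ?_
      exact (continuous_norm.comp (continuous_unitaryProd_inv (halg x (b.coord i)))).pow 2
    have hψ1 : ψ 1 ≠ 0 := by
      intro h0
      apply hx0
      apply b.ext_elem
      intro i
      have := (Finset.sum_eq_zero_iff_of_nonneg (fun i _ => by positivity)).mp h0 i
        (Finset.mem_univ i)
      simpa using this
    have := hψc.integral_pos_of_hasCompactSupport_nonneg_nonzero (μ := m)
      (HasCompactSupport.of_compactSpace _)
      (fun k => Finset.sum_nonneg fun i _ => by positivity) hψ1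
    have h2 : form x x = ((∫ k, ψ k ∂m : ℝ) : ℂ) := by
      have h3 : ∫ k, ((ψ k : ℝ) : ℂ) ∂m = ((∫ k, ψ k ∂m : ℝ) : ℂ) := integral_ofReal
      rw [hform, ← h3]
      congr 1; funext k
      exact hφψ k
    rw [h2] at hx
    exact this.ne' (by exact_mod_cast hx)
  · rw [hform, hform, ← integral_mul_left_eq_self (μ := m) (fun k => φ _ _ k) h]
    congr 1; funext k
    have e : ∀ z, ρ (unitaryProd n (h * k))⁻¹ (ρ (unitaryProd n h) z) =
        ρ (unitaryProd n k)⁻¹ z := fun z => by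
      rw [← Module.End.mul_apply, ← map_mul, map_mul (unitaryProd n), mul_inv_rev, inv_mul_cancel_right]
    simp only [φ, e]

/-- For unitary `g` one has `star g = g⁻¹`, so contravariance is invariance there. Zariski density
extends it to all `g`. -/
theorem exists_contravariantForm {V : Type*} [AddCommGroup V] [Module ℂ V]
    [FiniteDimensional ℂ V] (ρ : Representation ℂ (GC n) V)
    (halg : ∀ (v : V) (l : Module.Dual ℂ V), (fun g => l (ρ g v)) ∈ regularGC n) :
    Nonempty (ContravariantForm ρ) := by
  obtain ⟨form, hs, hd, hk⟩ := exists_unitary_invariant_form ρ halg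
  refine ⟨⟨form, hs, hd, fun g x y => ?_⟩⟩
  -- Conjugating both the value and the argument makes the second term regular in `g`.
  have hreg : (fun g => form x (ρ g y) - star (form y (ρ (star g) x))) ∈ regularGC n :=
    Subalgebra.sub_mem _ (halg y (form x))
      (conjTranspose_mem_regularGC (f := fun g => form y (ρ g x)) (halg x (form y)))
  have := eq_zero_of_unitary_prod hreg (fun u v hu hv => ?_) (star g)
  · rw [star_star, hs, sub_eq_zero] at this
    exact this.symm
  · have hu' : star u = u⁻¹ := (inv_eq_of_mul_eq_one_right hu).symm
    have hv' : star v = v⁻¹ := (inv_eq_of_mul_eq_one_right hv).symm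
    let k : Matrix.unitaryGroup (Fin n) ℂ × Matrix.unitaryGroup (Fin n) ℂ :=
      (⟨u, Matrix.mem_unitaryGroup_iff.mpr (congrArg Units.val hu)⟩,
        ⟨v, Matrix.mem_unitaryGroup_iff.mpr (congrArg Units.val hv)⟩)
    have hkuv : unitaryProd n k = (u, v) := Prod.ext (Units.ext rfl) (Units.ext rfl)
    have hstar : star (u, v) = (unitaryProd n k)⁻¹ := by
      rw [hkuv]
      exact Prod.ext hu' hv'
    rw [hs, hstar, ← hkuv, sub_eq_zero, ← hk k (ρ (unitaryProd n k)⁻¹ x), ← Module.End.mul_apply,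
      ← map_mul, mul_inv_cancel, map_one, Module.End.one_apply]

end ContravariantForms

/-! ### Irreducibility -/

section Irreducibility

variable {G V : Type*} [Group G] [AddCommGroup V] [Module ℂ V]

theorem isIrreducible_iff_submodule (ρ : Representation ℂ G V) :
    ρ.IsIrreducible ↔ Nontrivial V ∧
      ∀ W : Submodule ℂ V, (∀ g, ∀ v ∈ W, ρ g v ∈ W) → W = ⊥ ∨ W = ⊤ := by
  constructor
  · intro h
    refine ⟨?_, fun W hW => ?_⟩
    · by_contra hV
      rw [not_nontrivial_iff_subsingleton] at hV
      refine bot_ne_top (α := Subrepresentation ρ) (Subrepresentation.toSubmodule_injective ?_)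
      exact Subsingleton.elim _ _
    · rcases h.eq_bot_or_eq_top ⟨W, fun g v hv => hW g v hv⟩ with h | h
      · exact Or.inl (congrArg Subrepresentation.toSubmodule h)
      · exact Or.inr (congrArg Subrepresentation.toSubmodule h)
  · rintro ⟨hV, h⟩
    have : Nontrivial (Subrepresentation ρ) := by
      refine ⟨⊥, ⊤, fun h' => ?_⟩
      exact bot_ne_top (α := Submodule ℂ V) (congrArg Subrepresentation.toSubmodule h')
    refine ⟨fun W => ?_⟩
    rcases h W.toSubmodule (fun g v hv => W.apply_mem_toSubmodule g hv) with h | h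
    · exact Or.inl (Subrepresentation.toSubmodule_injective h)
    · exact Or.inr (Subrepresentation.toSubmodule_injective h)

theorem span_orbit_eq_top {ρ : Representation ℂ G V} (hρ : ρ.IsIrreducible) {v : V} (hv : v ≠ 0) :
    Submodule.span ℂ (Set.range fun g => ρ g v) = ⊤ := by
  refine (((isIrreducible_iff_submodule ρ).mp hρ).2 _ fun g w hw => ?_).resolve_left fun h => hv ?_
  · induction hw using Submodule.span_induction with
    | mem x hx =>
      obtain ⟨h, rfl⟩ := hx
      refine Submodule.subset_span ⟨g * h, ?_⟩
      simp [map_mul]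
    | zero => simp
    | add x y _ _ hx hy => rw [map_add]; exact Submodule.add_mem _ hx hy
    | smul c x _ hx => rw [map_smul]; exact Submodule.smul_mem _ _ hx
  · have : v ∈ Submodule.span ℂ (Set.range fun g => ρ g v) :=
      Submodule.subset_span ⟨1, by simp⟩
    rw [h] at this
    simpa using this

theorem isIrreducible_comp_iff {H : Type*} [Group H] (ρ : Representation ℂ G V) {f : H →* G}
    (hf : Function.Surjective f) :
    Representation.IsIrreducible (MonoidHom.comp ρ f : Representation ℂ H V) ↔
      ρ.IsIrreducible := by
  rw [isIrreducible_iff_submodule, isIrreducible_iff_submodule]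
  refine and_congr_right fun _ => forall_congr' fun W => ?_
  rw [hf.forall]
  rfl

theorem isIrreducible_dual [FiniteDimensional ℂ V] {ρ : Representation ℂ G V}
    (hρ : ρ.IsIrreducible) : ρ.dual.IsIrreducible := by
  obtain ⟨hV, h⟩ := (isIrreducible_iff_submodule ρ).mp hρ
  rw [isIrreducible_iff_submodule]
  refine ⟨inferInstance, fun W hW => ?_⟩
  have hst : ∀ g, ∀ v ∈ W.dualCoannihilator, ρ g v ∈ W.dualCoannihilator := by
    intro g v hv
    rw [Submodule.mem_dualCoannihilator] at hv ⊢
    intro l hl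
    have := hv _ (hW g⁻¹ l hl)
    rw [Representation.dual_apply, inv_inv] at this
    exact this
  have hWW : W.dualCoannihilator.dualAnnihilator = W :=
    Subspace.dualCoannihilator_dualAnnihilator_eq
  rcases h _ hst with h | h
  · right; rw [← hWW, h, Submodule.dualAnnihilator_bot]
  · left; rw [← hWW, h, Submodule.dualAnnihilator_top]

end Irreducibility

/-! ### Characters of triangular matrices -/

section Characters

variable {n : ℕ}

theorem IsUpperTriangular.mul_diag {b c : GLC n} (hb : IsUpperTriangular b)
    (hc : IsUpperTriangular c) (i : Fin n) :
    ((b * c : GLC n) : Matrix (Fin n) (Fin n) ℂ) i i =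
      (b : Matrix (Fin n) (Fin n) ℂ) i i * (c : Matrix (Fin n) (Fin n) ℂ) i i := by
  rw [Units.val_mul, Matrix.mul_apply]
  refine Finset.sum_eq_single i (fun k _ hk => ?_) (by simp)
  rcases lt_or_gt_of_ne hk with h | h
  · rw [hb i k h, zero_mul]
  · rw [hc k i h, mul_zero]

theorem IsUpperTriangular.inv_diag {b : GLC n} (hb : IsUpperTriangular b) (i : Fin n) :
    ((b⁻¹ : GLC n) : Matrix (Fin n) (Fin n) ℂ) i i = ((b : Matrix (Fin n) (Fin n) ℂ) i i)⁻¹ := by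
  have := hb.inv.mul_diag hb i
  rw [inv_mul_cancel] at this
  exact eq_inv_of_mul_eq_one_left (by simpa using this.symm)

theorem IsUpperTriangular.diag_ne_zero {b : GLC n} (hb : IsUpperTriangular b) (i : Fin n) :
    (b : Matrix (Fin n) (Fin n) ℂ) i i ≠ 0 := by
  have := hb.inv.mul_diag hb i
  rw [inv_mul_cancel] at this
  exact right_ne_zero_of_mul (a := ((b⁻¹ : GLC n) : Matrix (Fin n) (Fin n) ℂ) i i)
    (by rw [← this]; simp)

theorem IsUpperTriangular.borelChar_inv {b : GLC n} (hb : IsUpperTriangular b) (a : Fin n → ℤ) :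
    borelChar a b⁻¹ = borelChar (fun i => -a i) b := by
  simp only [borelChar, hb.inv_diag, inv_zpow']

theorem IsUpperTriangular.borelChar_add {b : GLC n} (hb : IsUpperTriangular b)
    (a c : Fin n → ℤ) : borelChar (fun i => a i + c i) b = borelChar a b * borelChar c b := by
  simp only [borelChar, zpow_add₀ (hb.diag_ne_zero _), Finset.prod_mul_distrib]

theorem borelChar_star (a : Fin n → ℤ) (b : GLC n) :
    borelChar a (star b) = star (borelChar a b) := by
  change _ = (starRingEnd ℂ) _
  rw [borelChar, borelChar, map_prod]
  exact Finset.prod_congr rfl fun i _ => by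
    rw [map_zpow₀, Units.coe_star, Matrix.star_apply]
    rfl

theorem IsUpperTriangular.borelChar_invTranspose {b : GLC n} (hb : IsUpperTriangular b)
    (a : Fin n → ℤ) : borelChar a (RankinSelberg.invTranspose b) = borelChar (fun i => -a i) b := by
  rw [← hb.borelChar_inv]
  rfl

/-- The longest element of the Weyl group, as a permutation matrix. -/
def weyl (n : ℕ) : GLC n where
  val := Matrix.of fun i j => if i.rev = j then 1 else 0
  inv := Matrix.of fun i j => if i.rev = j then 1 else 0
  val_inv := by ext i j; simp [Matrix.mul_apply, Matrix.one_apply, Fin.rev_eq_iff]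
  inv_val := by ext i j; simp [Matrix.mul_apply, Matrix.one_apply, Fin.rev_eq_iff]

theorem weyl_mul_self : weyl n * weyl n = 1 := Units.ext (weyl n).val_inv

theorem weyl_inv : (weyl n)⁻¹ = weyl n := rfl

theorem weyl_conj_apply (g : GLC n) (i j : Fin n) :
    ((weyl n * g * weyl n : GLC n) : Matrix (Fin n) (Fin n) ℂ) i j =
      (g : Matrix (Fin n) (Fin n) ℂ) i.rev j.rev := by
  have h1 : ∀ k, (weyl n).val i k = if i.rev = k then 1 else 0 := fun k => rfl
  have h2 : ∀ k, (weyl n).val k j = if k = j.rev then 1 else 0 := fun k =>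
    if_congr Fin.rev_eq_iff rfl rfl
  simp [Matrix.mul_apply, h1, h2]

theorem IsUpperTriangular.weyl_conj {g : GLC n} (hg : IsUpperTriangular g) :
    IsLowerTriangular (weyl n * g * weyl n) := fun i k hik => by
  rw [weyl_conj_apply]
  exact hg _ _ (Fin.rev_lt_rev.mpr hik)

theorem IsLowerTriangular.weyl_conj {g : GLC n} (hg : IsLowerTriangular g) :
    IsUpperTriangular (weyl n * g * weyl n) := fun i k hik => by
  rw [weyl_conj_apply]
  exact hg _ _ (Fin.rev_lt_rev.mpr hik)

theorem borelChar_weyl_conj (a : Fin n → ℤ) (g : GLC n) :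
    borelChar a (weyl n * g * weyl n) = borelChar (fun i => a i.rev) g := by
  simp only [borelChar, weyl_conj_apply]
  exact Fintype.prod_equiv Fin.revPerm _ _ fun i => by simp

end Characters

/-! ### Dual representations -/

section Dual

variable {n : ℕ} {V : Type*} [AddCommGroup V] [Module ℂ V]

/-- Lets duals and contravariant forms for `GL_n` be deduced from those for `GL_n × GL_n`. -/
theorem IsIrrepGL.comp_fst {ρ : Representation ℂ (GLC n) V} {a : Fin n → ℤ} (h : IsIrrepGL ρ a) :
    IsIrrepGC (ρ.comp (MonoidHom.fst (GLC n) (GLC n))) ⟨a, 0⟩ where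
  finiteDimensional := h.finiteDimensional
  algebraic v l := comp_fst_mem_regularGC (h.algebraic v l)
  irreducible := (isIrreducible_comp_iff ρ (f := MonoidHom.fst (GLC n) (GLC n))
    Prod.fst_surjective).mpr h.irreducible
  highestWeight := by
    obtain ⟨v, hv, hb⟩ := h.highestWeight
    refine ⟨v, hv, fun b₁ b₂ h₁ _ => ?_⟩
    have : borelChar 0 b₂ = 1 := by simp [borelChar]
    rw [this, mul_one]
    exact hb b₁ h₁

theorem isIrrepGL_of_comp_fst {ρ : Representation ℂ (GLC n) V} {a : Weight n}
    (h : IsIrrepGC (ρ.comp (MonoidHom.fst (GLC n) (GLC n))) a) : IsIrrepGL ρ a.left where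
  finiteDimensional := h.finiteDimensional
  algebraic v l := left_mem_regularGL (h.algebraic v l) 1
  irreducible := (isIrreducible_comp_iff ρ (f := MonoidHom.fst (GLC n) (GLC n))
    Prod.fst_surjective).mp h.irreducible
  highestWeight := by
    obtain ⟨v, hv, hb⟩ := h.highestWeight
    refine ⟨v, hv, fun b hb' => ?_⟩
    have h1 : borelChar a.right (1 : GLC n) = 1 := by simp [borelChar]
    have := hb b 1 hb' (fun i k hik => by simp [hik.ne'])
    rwa [h1, mul_one] at this

/-- The highest weight of the dual representation. -/
def Weight.dual (a : Weight n) : Weight n := ⟨fun i => -a.left i.rev, fun i => -a.right i.rev⟩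

theorem Weight.dual_toKWeight (a : Weight n) :
    a.dual.toKWeight = fun i => -a.toKWeight i.rev := by
  funext i
  simp [Weight.dual, Weight.toKWeight]
  ring

/-- Pairing with the highest weight vector in a contravariant form gives a lower triangular
eigenvector of the dual; the longest Weyl element turns it into a highest weight vector. -/
theorem IsIrrepGC.dual {ρ : Representation ℂ (GC n) V} {a : Weight n} (h : IsIrrepGC ρ a) :
    IsIrrepGC ρ.dual a.dual := by
  have := h.finiteDimensional
  refine ⟨inferInstance, fun l L => ?_, isIrreducible_dual h.irreducible, ?_⟩
  · obtain ⟨v, rfl⟩ := (Module.evalEquiv ℂ V).surjective L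
    exact inv_mem_regularGC (h.algebraic v l)
  · obtain ⟨v, hv, hb⟩ := h.highestWeight
    obtain ⟨B⟩ := exists_contravariantForm ρ h.algebraic
    let l : Module.Dual ℂ V := B.form v
    have hl : l ≠ 0 := fun h0 => hv (B.definite v (by change l v = 0; rw [h0]; rfl))
    let w : GC n := (weyl n, weyl n)
    refine ⟨ρ.dual w l, fun h0 => hl ?_, fun b₁ b₂ h₁ h₂ => ?_⟩
    · have := congrArg (ρ.dual w⁻¹) h0
      rwa [← Module.End.mul_apply, ← map_mul, inv_mul_cancel, map_one, map_zero] at this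
    · have key : ∀ x, l (ρ (w * (b₁, b₂)⁻¹ * w) x) =
          (borelChar a.dual.left b₁ * borelChar a.dual.right b₂) * l x := by
        intro x
        change B.form v (ρ (weyl n * b₁⁻¹ * weyl n, weyl n * b₂⁻¹ * weyl n) x) = _ * B.form v x
        have e := B.contra (star (weyl n * b₁⁻¹ * weyl n, weyl n * b₂⁻¹ * weyl n)) v x
        rw [star_star] at e
        rw [← e]
        change B.form (ρ (star (weyl n * b₁⁻¹ * weyl n), star (weyl n * b₂⁻¹ * weyl n)) v) x = _
        rw [hb _ _ h₁.inv.weyl_conj.star h₂.inv.weyl_conj.star, map_smulₛₗ, LinearMap.smul_apply,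
          borelChar_star, borelChar_star, borelChar_weyl_conj, borelChar_weyl_conj,
          h₁.borelChar_inv, h₂.borelChar_inv, smul_eq_mul, map_mul]
        congr 1
        exact congrArg₂ _ (star_star _) (star_star _)
      ext x
      have hw : w⁻¹ = w := rfl
      have hww : w * w = 1 := Prod.ext weyl_mul_self weyl_mul_self
      have := key (ρ w x)
      simp only [Representation.dual_apply, Module.Dual.transpose_apply, LinearMap.comp_apply,
        LinearMap.smul_apply, smul_eq_mul, hw, ← Module.End.mul_apply, ← map_mul] at this ⊢
      rw [← this, mul_assoc _ w w, hww, mul_one]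

theorem IsIrrepGL.dual {ρ : Representation ℂ (GLC n) V} {a : Fin n → ℤ} (h : IsIrrepGL ρ a) :
    IsIrrepGL ρ.dual fun i => -a i.rev :=
  isIrrepGL_of_comp_fst (a := Weight.dual ⟨a, 0⟩) h.comp_fst.dual

theorem IsKType.dual {𝕂 : Type*} [Field 𝕂] {ι₁ ι₂ : 𝕂 ≃+* ℂ}
    {τ : Representation ℂ (unitaryK ι₁ ι₂ n) V} {a : Weight n}
    (h : IsKType ι₁ ι₂ τ a.toKWeight) : IsKType ι₁ ι₂ τ.dual a.dual.toKWeight := by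
  obtain ⟨E, hE, hτ⟩ := h
  refine ⟨E.dual, ?_, fun k => ?_⟩
  · rw [Weight.dual_toKWeight]
    exact hE.dual
  · rw [Representation.dual_apply, Representation.dual_apply, hτ, map_inv, Prod.fst_inv]

end Dual

/-! ### Extremal vectors: existence, equivariant maps, multiplicity one -/

section KTypes

variable {n : ℕ}

theorem twistedDiag_apply (g : GLC n) : twistedDiag n g = (g, invTranspose g) := rfl

theorem star_invTranspose (g : GLC n) : star (invTranspose g) = invTranspose (star g) := by
  apply Units.ext
  rw [Units.coe_star, coe_invTranspose, coe_invTranspose, ← star_inv, Units.coe_star]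
  rfl

theorem star_twistedDiag (g : GLC n) : star (twistedDiag n g) = twistedDiag n (star g) :=
  Prod.ext rfl (star_invTranspose g)

/-- A contravariant form restricts along a homomorphism compatible with the involutions. -/
def ContravariantForm.comp {G H V : Type*} [Group G] [StarMul G] [Group H] [StarMul H]
    [AddCommGroup V] [Module ℂ V] {ρ : Representation ℂ G V} (B : ContravariantForm ρ)
    (f : H →* G) (hf : ∀ h, star (f h) = f (star h)) :
    ContravariantForm (ρ.comp f : Representation ℂ H V) where
  form := B.form
  symm := B.symm
  definite := B.definite
  contra h x y := by
    have := B.contra (f h) x y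
    rw [hf] at this
    exact this

theorem exists_contravariantForm_GL {V : Type*} [AddCommGroup V] [Module ℂ V]
    {ρ : Representation ℂ (GLC n) V} {a : Fin n → ℤ} (h : IsIrrepGL ρ a) :
    Nonempty (ContravariantForm ρ) := by
  have := h.finiteDimensional
  obtain ⟨B⟩ := exists_contravariantForm _ h.comp_fst.algebraic
  exact ⟨B.comp (MonoidHom.inl _ _) fun g => Prod.ext rfl (star_one _)⟩

/-- The Borel of the second factor is reversed because the twisted diagonal sends an upper
triangular `b` to the pair of `b` and the lower triangular `b⁻ᵗ`. -/
theorem IsIrrepGC.exists_extremal {V : Type*} [AddCommGroup V] [Module ℂ V]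
    {ρ : Representation ℂ (GC n) V} {a : Weight n} (h : IsIrrepGC ρ a) :
    ∃ x : V, x ≠ 0 ∧ ∀ b l : GLC n, IsUpperTriangular b → IsLowerTriangular l →
      ρ (b, l) x = (borelChar a.left b * borelChar (fun i => a.right i.rev) l) • x := by
  obtain ⟨v, hv, hb⟩ := h.highestWeight
  refine ⟨ρ (1, weyl n) v, fun h0 => hv ?_, fun b l hb' hl => ?_⟩
  · have := congrArg (ρ (1, weyl n)⁻¹) h0
    rwa [← Module.End.mul_apply, ← map_mul, inv_mul_cancel, map_one, map_zero] at this
  · have e : ((b, l) * (1, weyl n) : GC n) = (1, weyl n) * (b, weyl n * l * weyl n) := by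
      refine Prod.ext (by simp) ?_
      simp only [Prod.snd_mul, ← mul_assoc, weyl_mul_self, one_mul]
    rw [← Module.End.mul_apply, ← map_mul, e, map_mul, Module.End.mul_apply,
      hb _ _ hb' hl.weyl_conj, map_smul, borelChar_weyl_conj]

theorem borelChar_twistedDiag (a : Weight n) {b : GLC n} (hb : IsUpperTriangular b) :
    borelChar a.left b * borelChar (fun i => a.right i.rev) (invTranspose b) =
      borelChar a.toKWeight b := by
  rw [hb.borelChar_invTranspose, ← hb.borelChar_add]
  rfl

/-- Proportional Gram matrices give a linear map. -/
theorem exists_linearMap_of_gram {I T X : Type*} [AddCommGroup T] [Module ℂ T] [AddCommGroup X]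
    [Module ℂ X] (A : T →ₗ⋆[ℂ] T →ₗ[ℂ] ℂ) (B : X →ₗ⋆[ℂ] X →ₗ[ℂ] ℂ)
    (hB : ∀ x, B x x = 0 → x = 0) (u : I → T) (y : I → X) (c : ℂ)
    (hu : Submodule.span ℂ (Set.range u) = ⊤) (h : ∀ i j, B (y i) (y j) = c * A (u i) (u j)) :
    ∃ f : T →ₗ[ℂ] X, ∀ i, f (u i) = y i := by
  let Lu := Finsupp.linearCombination ℂ u
  let Ly := Finsupp.linearCombination ℂ y
  have hsurj : LinearMap.range Lu = ⊤ := by rw [Finsupp.range_linearCombination, hu]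
  have hform : ∀ s s', B (Ly s) (Ly s') = c * A (Lu s) (Lu s') := by
    intro s s'
    simp only [Ly, Lu, Finsupp.linearCombination_apply, Finsupp.sum, map_sum, map_smulₛₗ,
      LinearMap.sum_apply, LinearMap.smul_apply, h, Finset.mul_sum, smul_eq_mul, RingHom.id_apply]
    exact Finset.sum_congr rfl fun i _ => Finset.sum_congr rfl fun j _ => by ring
  -- A linear relation among the `u i` gives a combination of the `y i` of norm zero, which vanishes
  -- since `B` is definite.
  have hker : ∀ s, Lu s = 0 → Ly s = 0 := fun s hs => hB _ (by rw [hform, hs]; simp)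
  obtain ⟨r, hr⟩ := Lu.exists_rightInverse_of_surjective hsurj
  refine ⟨Ly ∘ₗ r, fun i => ?_⟩
  have h0 : Lu (r (u i) - Finsupp.single i 1) = 0 := by
    have : Lu (r (u i)) = u i := LinearMap.congr_fun hr (u i)
    rw [map_sub, this]
    simp [Lu]
  have := hker _ h0
  rw [map_sub, sub_eq_zero] at this
  rw [LinearMap.comp_apply, this]
  simp [Ly]

/-- Moved across the form, `l` becomes the upper triangular `star l`. So the matrix coefficient of a
highest weight vector depends, up to the factor `B.form v v`, on its weight only. -/
theorem ContravariantForm.form_bigCell {V : Type*} [AddCommGroup V] [Module ℂ V]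
    {ρ : Representation ℂ (GLC n) V} (B : ContravariantForm ρ) {a : Fin n → ℤ} {v : V}
    (hv : ∀ b, IsUpperTriangular b → ρ b v = borelChar a b • v) {l b : GLC n}
    (hl : IsLowerTriangular l) (hb : IsUpperTriangular b) :
    B.form v (ρ (l * b) v) = borelChar a l * borelChar a b * B.form v v := by
  have e := B.contra (star l) v (ρ b v)
  rw [star_star, ← Module.End.mul_apply, ← map_mul] at e
  rw [← e, hv b hb, hv _ hl.star, map_smul, map_smulₛₗ B.form, LinearMap.smul_apply, borelChar_star,
    smul_eq_mul, smul_eq_mul, mul_left_comm, ← mul_assoc]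
  congr 2
  exact star_star _

/-- The matrix coefficients of `t` and `x` are proportional on the big cell, hence everywhere, so
their orbits have proportional Gram matrices. Irreducibility of the target is not needed, which is
why this applies to the restriction to the twisted diagonal. -/
theorem exists_equivariant_of_highestWeight {T X : Type*} [AddCommGroup T] [Module ℂ T]
    [AddCommGroup X] [Module ℂ X] {E : Representation ℂ (GLC n) T}
    {σ : Representation ℂ (GLC n) X} (A : ContravariantForm E) (B : ContravariantForm σ)
    (hE : E.IsIrreducible)
    (hEalg : ∀ (v : T) (l : Module.Dual ℂ T), (fun g => l (E g v)) ∈ regularGL n)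
    (hσalg : ∀ (v : X) (l : Module.Dual ℂ X), (fun g => l (σ g v)) ∈ regularGL n)
    {a : Fin n → ℤ} {t : T} {x : X} (ht0 : t ≠ 0)
    (ht : ∀ b, IsUpperTriangular b → E b t = borelChar a b • t)
    (hx : ∀ b, IsUpperTriangular b → σ b x = borelChar a b • x) :
    ∃ f : T →ₗ[ℂ] X, f t = x ∧ ∀ g y, f (E g y) = σ g (f y) := by
  have hAt : A.form t t ≠ 0 := fun h => ht0 (A.definite t h)
  have hgram : ∀ g, A.form t t * B.form x (σ g x) - B.form x x * A.form t (E g t) = 0 := by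
    refine eq_zero_of_bigCell (f := fun g => A.form t t * B.form x (σ g x) -
      B.form x x * A.form t (E g t)) ?_ fun l b hl hb => ?_
    · exact Subalgebra.sub_mem _
        (Subalgebra.mul_mem _ ((regularGL n).algebraMap_mem _) (hσalg x (B.form x)))
        (Subalgebra.mul_mem _ ((regularGL n).algebraMap_mem _) (hEalg t (A.form t)))
    · simp only [A.form_bigCell ht hl hb, B.form_bigCell hx hl hb]
      ring
  have hspan := span_orbit_eq_top hE ht0
  obtain ⟨f, hf⟩ := exists_linearMap_of_gram A.form B.form B.definite (fun g => E g t)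
    (fun g => σ g x) (B.form x x / A.form t t) hspan (fun g h => by
      rw [A.contra, B.contra, ← Module.End.mul_apply, ← map_mul, ← Module.End.mul_apply,
        ← map_mul, div_mul_eq_mul_div, eq_div_iff hAt]
      have := hgram (star g * h)
      linear_combination this)
  refine ⟨f, by simpa using hf 1, fun g y => ?_⟩
  have hy : y ∈ Submodule.span ℂ (Set.range fun g => E g t) := hspan ▸ Submodule.mem_top
  induction hy using Submodule.span_induction with
  | mem y hy =>
    obtain ⟨h, rfl⟩ := hy
    change f (E g (E h t)) = σ g (f (E h t))
    rw [hf h, ← Module.End.mul_apply, ← map_mul, hf, ← Module.End.mul_apply, ← map_mul]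
  | zero => simp
  | add y z _ _ hy hz => simp only [map_add, hy, hz]
  | smul c y _ hy => simp only [map_smul, hy]

/-! ### Uniqueness of the extremal vector -/

/-- The conjugate of a lower triangular matrix by `diag(1, s, s², …)`, extended to `s = 0`. -/
def contraction {l : GLC n} (hl : IsLowerTriangular l) (s : ℂ) : GLC n :=
  Matrix.GeneralLinearGroup.mkOfDetNeZero
    (Matrix.of fun i j : Fin n => s ^ ((i : ℕ) - j) * (l : Matrix (Fin n) (Fin n) ℂ) i j) (by
      rw [Matrix.det_of_isLowerTriangular _ fun i j (hij : i < j) => by simp [hl i j hij]]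
      have h := (Matrix.isUnits_det_units l).ne_zero
      rw [Matrix.det_of_isLowerTriangular _ fun i j (hij : i < j) => hl i j hij] at h
      simpa using h)

theorem contraction_apply {l : GLC n} (hl : IsLowerTriangular l) (s : ℂ) (i j : Fin n) :
    (contraction hl s : Matrix (Fin n) (Fin n) ℂ) i j =
      s ^ ((i : ℕ) - j) * (l : Matrix (Fin n) (Fin n) ℂ) i j := rfl

theorem contraction_units {l : GLC n} (hl : IsLowerTriangular l) (s : ℂˣ) :
    contraction hl s = diagGL (fun i => s ^ (i : ℕ)) * l * (diagGL fun i => s ^ (i : ℕ))⁻¹ := by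
  rw [eq_mul_inv_iff_mul_eq]
  apply Units.ext
  ext i j
  rw [Units.val_mul, Units.val_mul, coe_diagGL, Matrix.mul_diagonal, Matrix.diagonal_mul,
    contraction_apply]
  rcases le_or_gt j i with h | h
  · have : (s : ℂ) ^ (i : ℕ) = (s : ℂ) ^ ((i : ℕ) - j) * (s : ℂ) ^ (j : ℕ) := by
      rw [← pow_add, Nat.sub_add_cancel h]
    rw [Units.val_pow_eq_pow_val, Units.val_pow_eq_pow_val, this]
    ring
  · simp [hl i j h]

theorem isUpperTriangular_contraction_zero {l : GLC n} (hl : IsLowerTriangular l) :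
    IsUpperTriangular (contraction hl 0) := fun i k hik => by
  rw [contraction_apply, zero_pow (Nat.sub_ne_zero_of_lt hik), zero_mul]

theorem isUpperTriangular_diagGL (x : Fin n → ℂˣ) : IsUpperTriangular (diagGL x) :=
  fun _ _ hik => Matrix.diagonal_apply_ne _ hik.ne'

theorem isLowerTriangular_diagGL (x : Fin n → ℂˣ) : IsLowerTriangular (diagGL x) :=
  fun _ _ hik => Matrix.diagonal_apply_ne _ hik.ne

theorem star_diagGL (x : Fin n → ℂˣ) : star (diagGL x) = diagGL (star x) := by
  apply Units.ext
  rw [Units.coe_star, coe_diagGL, coe_diagGL, Matrix.star_eq_conjTranspose,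
    Matrix.diagonal_conjTranspose]
  rfl

/-- The part `z` of `y` orthogonal to `x` is shown to be orthogonal to the whole orbit of `x`. On
the big cell only translates by (lower, upper) pairs matter. Conjugation by a one-parameter torus
contracts such a pair to a diagonal one without changing the pairing, as `z` and `x` have the same
weight; in the limit the pairing is a multiple of that of `z` with `x`. -/
theorem extremal_unique {V : Type*} [AddCommGroup V] [Module ℂ V]
    {ρ : Representation ℂ (GC n) V} {a : Weight n} (h : IsIrrepGC ρ a) {x y : V} (hx0 : x ≠ 0)
    (hx : ∀ b l : GLC n, IsUpperTriangular b → IsLowerTriangular l →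
      ρ (b, l) x = (borelChar a.left b * borelChar (fun i => a.right i.rev) l) • x)
    (hy : ∀ d, ρ (twistedDiag n (diagGL d)) y = borelChar a.toKWeight (diagGL d) • y) :
    ∃ c : ℂ, y = c • x := by
  have := h.finiteDimensional
  obtain ⟨B⟩ := exists_contravariantForm ρ h.algebraic
  have hxx : B.form x x ≠ 0 := fun h => hx0 (B.definite x h)
  have hxd : ∀ d, ρ (twistedDiag n (diagGL d)) x = borelChar a.toKWeight (diagGL d) • x :=
    fun d => by
      rw [← borelChar_twistedDiag a (isUpperTriangular_diagGL d)]
      exact hx _ _ (isUpperTriangular_diagGL d) (isUpperTriangular_diagGL d).invTranspose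
  refine ⟨B.form x y / B.form x x, ?_⟩
  set z := y - (B.form x y / B.form x x) • x with hz
  have hzd : ∀ d, ρ (twistedDiag n (diagGL d)) z = borelChar a.toKWeight (diagGL d) • z := by
    intro d
    rw [hz, map_sub, map_smul, hy, hxd, smul_sub, smul_comm]
  have hzx : B.form z x = 0 := by
    rw [← B.symm, hz, map_sub, map_smul, smul_eq_mul, div_mul_cancel₀ _ hxx, sub_self, star_zero]
  suffices hmain : ∀ g, B.form z (ρ g x) = 0 by
    rw [← sub_eq_zero]
    apply B.definite
    change B.form z z = 0
    have hzm : z ∈ Submodule.span ℂ (Set.range fun g => ρ g x) :=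
      span_orbit_eq_top h.irreducible hx0 ▸ Submodule.mem_top
    have : Submodule.span ℂ (Set.range fun g => ρ g x) ≤ LinearMap.ker (B.form z) := by
      rw [Submodule.span_le]
      rintro _ ⟨g, rfl⟩
      exact hmain g
    exact this hzm
  refine eq_zero_of_bigCell_prod (h.algebraic x (B.form z)) fun l₁ b₁ l₂ b₂ hl₁ hb₁ hl₂ hb₂ => ?_
  have e1 : ((l₁ * b₁, b₂ * l₂) : GC n) = (l₁, b₂) * (b₁, l₂) := rfl
  rw [e1, map_mul, Module.End.mul_apply, hx _ _ hb₁ hl₂, map_smul, map_smul, smul_eq_mul]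
  refine mul_eq_zero_of_right _ ?_
  -- Written as `b₂ = (b₂⁻ᵗ)⁻ᵗ` with `b₂⁻ᵗ` lower triangular, the second entry is contracted by the
  -- same twisted torus element as the first.
  have hl₃ := hb₂.invTranspose
  let θ : ℂ → GC n := fun s => (contraction hl₁ s, invTranspose (contraction hl₃ s))
  have hcont : Continuous fun s => B.form z (ρ (θ s) x) := by
    have hc : ∀ {l : GLC n} (hl : IsLowerTriangular l) (i j : Fin n),
        Continuous fun s => (contraction hl s : Matrix (Fin n) (Fin n) ℂ) i j := fun hl i j =>
      (continuous_pow _).mul continuous_const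
    exact regularGC_comp (contSubalgebra ℂ) θ
      (fun f hf => continuous_regularGL _ (hc hl₁) hf)
      (fun f hf => continuous_regularGL _ (hc hl₃) (invTranspose_mem_regularGL hf))
      (h.algebraic x (B.form z))
  have hconst : ∀ s ∈ ({0}ᶜ : Set ℂ), B.form z (ρ (θ s) x) = B.form z (ρ (l₁, b₂) x) := by
    intro s hs
    let u : ℂˣ := Units.mk0 s hs
    let d : Fin n → ℂˣ := fun i => u ^ (i : ℕ)
    have eθ : θ s = twistedDiag n (diagGL d) * (l₁, b₂) * twistedDiag n (diagGL d⁻¹) := by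
      have h1 := contraction_units hl₁ u
      have h2 := contraction_units hl₃ u
      refine Prod.ext ?_ ?_
      · change contraction hl₁ u = _
        rw [h1, ← map_inv]
        rfl
      · change invTranspose (contraction hl₃ u) = _
        rw [h2, ← map_inv, map_mul, map_mul, invTranspose_invTranspose]
        rfl
    rw [eθ, map_mul, map_mul, Module.End.mul_apply, Module.End.mul_apply, hxd, map_smul, map_smul,
      map_smul]
    have e := B.contra (star (twistedDiag n (diagGL d))) z (ρ (l₁, b₂) x)
    rw [star_star, star_twistedDiag, star_diagGL, hzd, map_smulₛₗ, LinearMap.smul_apply,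
      ← star_diagGL, borelChar_star] at e
    rw [← e, map_inv, (isUpperTriangular_diagGL d).borelChar_inv]
    have h3 : (starRingEnd ℂ) (star (borelChar a.toKWeight (diagGL d))) =
      borelChar a.toKWeight (diagGL d) := star_star _
    rw [h3, smul_eq_mul, smul_eq_mul, ← mul_assoc, ← (isUpperTriangular_diagGL d).borelChar_add]
    simp [borelChar]
  -- The pairing is constant for `s ≠ 0` and continuous, hence has the same value at `s = 0`, where
  -- both entries are diagonal.
  have hall := Continuous.ext_on (dense_compl_singleton (0 : ℂ)) hcont continuous_const hconst
  have h0 := congrFun hall 0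
  rw [← h0]
  change B.form z (ρ (contraction hl₁ 0, invTranspose (contraction hl₃ 0)) x) = 0
  rw [hx _ _ (isUpperTriangular_contraction_zero hl₁)
    (isUpperTriangular_contraction_zero hl₃).invTranspose, map_smul, hzx, smul_zero]

end KTypes

/-! ### Burnside's theorem -/

section Burnside

open scoped MonoidAlgebra

variable {G V : Type*} [Group G] [AddCommGroup V] [Module ℂ V]

theorem asAlgebraHom_mem_span (ρ : Representation ℂ G V) (r : ℂ[G]) :
    ρ.asAlgebraHom r ∈ Submodule.span ℂ (Set.range ρ) := by
  rw [Representation.asAlgebraHom_def, MonoidAlgebra.lift_apply]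
  exact Submodule.sum_mem _ fun g _ => Submodule.smul_mem _ _ (Submodule.subset_span ⟨g, rfl⟩)

/-- **Burnside's theorem**: an irreducible representation spans the endomorphism algebra. -/
theorem mem_span_range_of_isIrreducible [FiniteDimensional ℂ V] {ρ : Representation ℂ G V}
    (hρ : ρ.IsIrreducible) (A : V →ₗ[ℂ] V) : A ∈ Submodule.span ℂ (Set.range ρ) := by
  have hs : IsSimpleModule ℂ[G] ρ.asModule :=
    (Representation.irreducible_iff_isSimpleModule_asModule ρ).mp hρ
  have : FiniteDimensional ℂ ρ.asModule := ‹FiniteDimensional ℂ V›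
  have hbij : Function.Bijective (algebraMap ℂ (Module.End ℂ[G] ρ.asModule)) :=
    IsSimpleModule.algebraMap_end_bijective_of_isAlgClosed ℂ
  let e := ρ.asModuleEquiv
  -- By Schur's lemma the commutant consists of scalars, so every linear map is linear over it and
  -- the density theorem applies.
  let f : Module.End (Module.End ℂ[G] ρ.asModule) ρ.asModule :=
    { toFun := fun m => e.symm (A (e m))
      map_add' := fun x y => by simp
      map_smul' := fun c m => by
        obtain ⟨c, rfl⟩ := hbij.2 c
        simp }
  let b := Module.finBasis ℂ V
  classical
  obtain ⟨r, hr⟩ := jacobson_density f (Finset.univ.image fun i => e.symm (b i))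
  have hA : A = ρ.asAlgebraHom r := by
    refine b.ext fun i => ?_
    have := hr (e.symm (b i)) (Finset.mem_image_of_mem _ (Finset.mem_univ i))
    have h2 := congrArg e this
    simpa [f, e] using h2
  rw [hA]
  exact asAlgebraHom_mem_span ρ r

end Burnside

/-! ### Tensor products -/

section Tensor

variable {X Y : Type*} [AddCommGroup X] [Module ℂ X] [AddCommGroup Y] [Module ℂ Y]

theorem exists_dual_ne_zero {x : X} (hx : x ≠ 0) : ∃ f : Module.Dual ℂ X, f x ≠ 0 := by
  by_contra! h
  exact hx ((Module.forall_dual_apply_eq_zero_iff ℂ x).mp h)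

theorem tmul_ne_zero_of_ne_zero {x : X} {y : Y} (hx : x ≠ 0) (hy : y ≠ 0) : x ⊗ₜ[ℂ] y ≠ 0 := by
  obtain ⟨f, hf⟩ := exists_dual_ne_zero hx
  obtain ⟨g, hg⟩ := exists_dual_ne_zero hy
  intro h
  have := congrArg ((TensorProduct.lid ℂ ℂ).toLinearMap ∘ₗ TensorProduct.map f g) h
  simp [hf, hg] at this

/-- By Burnside a stable subspace is preserved by all operators on either factor. Rank one operators
then carry an element with a nonzero coordinate to any pure tensor. -/
theorem isIrreducible_tensor {G H₁ H₂ : Type*} [Group G] [Group H₁] [Group H₂]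
    [FiniteDimensional ℂ X] [FiniteDimensional ℂ Y] {ρ₁ : Representation ℂ H₁ X}
    {ρ₂ : Representation ℂ H₂ Y} (hρ₁ : ρ₁.IsIrreducible) (hρ₂ : ρ₂.IsIrreducible)
    (θ : Representation ℂ G (X ⊗[ℂ] Y))
    (h₁ : ∀ h, ∃ g, θ g = TensorProduct.map (ρ₁ h) LinearMap.id)
    (h₂ : ∀ h, ∃ g, θ g = TensorProduct.map LinearMap.id (ρ₂ h)) : θ.IsIrreducible := by
  obtain ⟨hX, -⟩ := (isIrreducible_iff_submodule ρ₁).mp hρ₁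
  obtain ⟨hY, -⟩ := (isIrreducible_iff_submodule ρ₂).mp hρ₂
  rw [isIrreducible_iff_submodule]
  constructor
  · obtain ⟨x, hx⟩ := exists_ne (0 : X)
    obtain ⟨y, hy⟩ := exists_ne (0 : Y)
    exact ⟨_, _, tmul_ne_zero_of_ne_zero hx hy⟩
  intro W hW
  have hA : ∀ A : X →ₗ[ℂ] X, ∀ w ∈ W, TensorProduct.map A LinearMap.id w ∈ W := by
    intro A w hw
    induction mem_span_range_of_isIrreducible hρ₁ A using Submodule.span_induction with
    | mem A hA =>
      obtain ⟨h, rfl⟩ := hA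
      obtain ⟨g, hg⟩ := h₁ h
      rw [← hg]
      exact hW g w hw
    | zero => simp
    | add A A' _ _ h h' => rw [TensorProduct.map_add_left]; exact W.add_mem h h'
    | smul c A _ h => rw [TensorProduct.map_smul_left]; exact W.smul_mem _ h
  have hB : ∀ A : Y →ₗ[ℂ] Y, ∀ w ∈ W, TensorProduct.map LinearMap.id A w ∈ W := by
    intro A w hw
    induction mem_span_range_of_isIrreducible hρ₂ A using Submodule.span_induction with
    | mem A hA =>
      obtain ⟨h, rfl⟩ := hA
      obtain ⟨g, hg⟩ := h₂ h
      rw [← hg]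
      exact hW g w hw
    | zero => simp
    | add A A' _ _ h h' => rw [TensorProduct.map_add_right]; exact W.add_mem h h'
    | smul c A _ h => rw [TensorProduct.map_smul_right]; exact W.smul_mem _ h
  rw [or_iff_not_imp_left]
  intro hW0
  obtain ⟨w, hw, hw0⟩ := W.ne_bot_iff.mp hW0
  let b₁ := Module.finBasis ℂ X
  let b₂ := Module.finBasis ℂ Y
  let b := b₁.tensorProduct b₂
  obtain ⟨⟨i, j⟩, hij⟩ : ∃ i, b.repr w i ≠ 0 := by
    by_contra! h
    exact hw0 (b.ext_elem fun i => by simpa using h i)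
  rw [eq_top_iff, ← TensorProduct.span_tmul_eq_top, Submodule.span_le]
  rintro _ ⟨x, y, rfl⟩
  have key : ∀ z : X ⊗[ℂ] Y, TensorProduct.map LinearMap.id ((b₂.coord j).smulRight y)
      (TensorProduct.map ((b₁.coord i).smulRight x) LinearMap.id z) =
        b.repr z (i, j) • x ⊗ₜ[ℂ] y := by
    intro z
    induction z with
    | zero => simp
    | tmul u v =>
      simp [b, TensorProduct.smul_tmul', TensorProduct.tmul_smul, smul_smul]
    | add u v hu hv => simp only [map_add, hu, hv, Finsupp.add_apply, add_smul]
  have := hB ((b₂.coord j).smulRight y) _ (hA ((b₁.coord i).smulRight x) w hw)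
  rw [key] at this
  simpa [smul_smul, hij] using W.smul_mem (b.repr w (i, j))⁻¹ this

theorem eq_of_slices_eq [FiniteDimensional ℂ Y] {z z' : X ⊗[ℂ] Y}
    (h : ∀ l : Module.Dual ℂ Y, TensorProduct.rid ℂ X (TensorProduct.map LinearMap.id l z) =
      TensorProduct.rid ℂ X (TensorProduct.map LinearMap.id l z')) : z = z' := by
  let b := Module.finBasis ℂ Y
  have key : ∀ z : X ⊗[ℂ] Y, z = ∑ i,
      TensorProduct.rid ℂ X (TensorProduct.map LinearMap.id (b.coord i) z) ⊗ₜ[ℂ] b i := by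
    intro z
    induction z with
    | zero => simp
    | tmul u v =>
      simp only [TensorProduct.map_tmul, LinearMap.id_apply, TensorProduct.rid_tmul,
        TensorProduct.smul_tmul, ← TensorProduct.tmul_sum]
      congr 1
      exact (b.sum_repr v).symm
    | add u v hu hv =>
      conv_lhs => rw [hu, hv]
      simp only [map_add, TensorProduct.add_tmul, Finset.sum_add_distrib]
  rw [key z, key z']
  simp only [h]

/-- Contracting `F` with a functional on `Y` and fixing the vector of `T'` gives an equivariant map
on the first factor, hence a multiple of `f₁`. This peels off tensor factors one by one. -/
theorem exists_tensor_factor {α β T T' : Type*} [AddCommGroup T] [Module ℂ T] [AddCommGroup T']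
    [Module ℂ T'] [FiniteDimensional ℂ Y] {a : α → T →ₗ[ℂ] T} {a' : α → X →ₗ[ℂ] X}
    {b : β → T' →ₗ[ℂ] T'} {b' : β → Y →ₗ[ℂ] Y} {f₁ : T →ₗ[ℂ] X} {t₀ : T} (ht₀ : f₁ t₀ ≠ 0)
    (huniq : ∀ f : T →ₗ[ℂ] X, (∀ i y, f (a i y) = a' i (f y)) → ∃ c : ℂ, f = c • f₁)
    (F : T ⊗[ℂ] T' →ₗ[ℂ] X ⊗[ℂ] Y)
    (hFa : ∀ i z, F (TensorProduct.map (a i) LinearMap.id z) =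
      TensorProduct.map (a' i) LinearMap.id (F z))
    (hFb : ∀ i z, F (TensorProduct.map LinearMap.id (b i) z) =
      TensorProduct.map LinearMap.id (b' i) (F z)) :
    ∃ F' : T' →ₗ[ℂ] Y, F = TensorProduct.map f₁ F' ∧ ∀ i y, F' (b i y) = b' i (F' y) := by
  obtain ⟨m, hm⟩ := exists_dual_ne_zero ht₀
  -- If `F` is `f₁ ⊗ F'`, then evaluating at `t₀` and pairing with `m` multiplies `F'` by `m (f₁
  -- t₀)`, which is divided out.
  let F' : T' →ₗ[ℂ] Y := (m (f₁ t₀))⁻¹ • ((TensorProduct.lid ℂ Y).toLinearMap ∘ₗ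
    TensorProduct.map m LinearMap.id ∘ₗ F ∘ₗ TensorProduct.mk ℂ T T' t₀)
  have hslice : ∀ (l : Module.Dual ℂ Y) (z : X ⊗[ℂ] Y),
      l (TensorProduct.lid ℂ Y (TensorProduct.map m LinearMap.id z)) =
        m (TensorProduct.rid ℂ X (TensorProduct.map LinearMap.id l z)) := by
    intro l z
    induction z with
    | zero => simp
    | tmul u v => simp [mul_comm]
    | add u v hu hv => simp only [map_add, hu, hv]
  refine ⟨F', TensorProduct.ext' fun t t' => eq_of_slices_eq fun l => ?_, fun i y => ?_⟩
  · let f : T →ₗ[ℂ] X := (TensorProduct.rid ℂ X).toLinearMap ∘ₗ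
      TensorProduct.map LinearMap.id l ∘ₗ F ∘ₗ (TensorProduct.mk ℂ T T').flip t'
    have hf : ∀ t, f t = TensorProduct.rid ℂ X (TensorProduct.map LinearMap.id l (F (t ⊗ₜ t'))) :=
      fun t => rfl
    obtain ⟨c, hc⟩ := huniq f fun i y => by
      have e := hFa i (y ⊗ₜ t')
      rw [TensorProduct.map_tmul, LinearMap.id_apply] at e
      rw [hf, hf, e]
      generalize F (y ⊗ₜ t') = z
      induction z with
      | zero => simp
      | tmul u v => simp
      | add u v hu hv => simp only [map_add, hu, hv]
    have hc0 : c = l (F' t') := by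
      simp only [F', LinearMap.smul_apply, map_smul, LinearMap.comp_apply, TensorProduct.mk_apply,
        LinearEquiv.coe_coe, hslice, ← hf, hc, smul_eq_mul]
      field_simp
    rw [← hf, hc, hc0]
    simp
  · have e := hFb i (t₀ ⊗ₜ y)
    rw [TensorProduct.map_tmul, LinearMap.id_apply] at e
    simp only [F', LinearMap.smul_apply, LinearMap.comp_apply, TensorProduct.mk_apply,
      LinearEquiv.coe_coe, e, map_smul]
    congr 1
    generalize F (t₀ ⊗ₜ y) = z
    induction z with
    | zero => simp
    | tmul u v => simp
    | add u v hu hv => simp only [map_add, hu, hv]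

end Tensor

/-! ### The compact group inside the twisted diagonal, and its types -/

section CompactGroup

variable {𝕂 : Type*} [Field 𝕂] {ι₁ ι₂ : 𝕂 ≃+* ℂ} {n : ℕ}

/-- The only continuous ring endomorphisms of `ℂ` are the identity and conjugation. -/
theorem isomorphism_eq_conj [TopologicalSpace 𝕂] (hι₁ : IsHomeomorph ι₁) (hι₂ : IsHomeomorph ι₂)
    (hι : ι₁ ≠ ι₂) (z : ℂ) : ι₂ (ι₁.symm z) = star z := by
  let f : ℂ →+* ℂ := (ι₂ : 𝕂 →+* ℂ).comp (ι₁.symm : ℂ →+* 𝕂)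
  have hf : Continuous f := by
    refine hι₂.continuous.comp ?_
    have h := (hι₁.homeomorph ι₁).symm.continuous
    convert h using 1
    funext z
    exact ((hι₁.homeomorph ι₁).toEquiv.symm_apply_eq.mpr (ι₁.apply_symm_apply z).symm).symm
  rcases Complex.ringHom_eq_id_or_conj_of_continuous hf with h | h
  · refine absurd (RingEquiv.ext fun x => ?_) hι
    have := RingHom.congr_fun h (ι₁ x)
    simpa [f] using this.symm
  · exact RingHom.congr_fun h z

theorem kToGC_eq_twistedDiag (k : unitaryK ι₁ ι₂ n) :
    kToGC ι₁ ι₂ n k = twistedDiag n (kToGC ι₁ ι₂ n k).1 := by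
  refine Prod.ext rfl ?_
  have h : ((kToGC ι₁ ι₂ n k).1 : Matrix (Fin n) (Fin n) ℂ) *
    ((kToGC ι₁ ι₂ n k).2 : Matrix (Fin n) (Fin n) ℂ)ᵀ = 1 := k.2
  apply Units.ext
  rw [twistedDiag_apply, coe_invTranspose, Units.inv_eq_of_mul_eq_one_right h,
    Matrix.transpose_transpose]

theorem exists_kToGC_eq (hconj : ∀ z, ι₂ (ι₁.symm z) = star z) {u : GLC n} (hu : u * star u = 1) :
    ∃ k : unitaryK ι₁ ι₂ n, kToGC ι₁ ι₂ n k = twistedDiag n u := by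
  let g : Matrix.GeneralLinearGroup (Fin n) 𝕂 :=
    Matrix.GeneralLinearGroup.map (ι₁.symm : ℂ →+* 𝕂) u
  have hg : complexify ι₁ ι₂ n g = twistedDiag n u := by
    refine Prod.ext (Units.ext ?_) (Units.ext ?_)
    · ext i j
      exact ι₁.apply_symm_apply _
    · rw [twistedDiag_apply, coe_invTranspose, inv_eq_of_mul_eq_one_right hu, Units.coe_star]
      ext i j
      rw [Matrix.transpose_apply, Matrix.star_apply]
      exact hconj _
  refine ⟨⟨g, ?_⟩, hg⟩
  change ((complexify ι₁ ι₂ n g).1 : Matrix (Fin n) (Fin n) ℂ) *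
    ((complexify ι₁ ι₂ n g).2 : Matrix (Fin n) (Fin n) ℂ)ᵀ = 1
  rw [hg, twistedDiag_apply, coe_invTranspose, Matrix.transpose_transpose, Units.mul_inv]

/-- A `K`-stable subspace is stable under `GL_n`: the matrix coefficients of its vectors against its
annihilator vanish on unitary matrices, hence everywhere. -/
theorem IsKType.isIrreducible (hconj : ∀ z, ι₂ (ι₁.symm z) = star z) {T : Type*} [AddCommGroup T]
    [Module ℂ T] {τ : Representation ℂ (unitaryK ι₁ ι₂ n) T} {a : Fin n → ℤ}
    (h : IsKType ι₁ ι₂ τ a) : τ.IsIrreducible := by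
  obtain ⟨E, hE, hτ⟩ := h
  obtain ⟨hT, hW⟩ := (isIrreducible_iff_submodule E).mp hE.irreducible
  refine (isIrreducible_iff_submodule τ).mpr ⟨hT, fun W hst => hW W fun g w hw => ?_⟩
  rw [← Subspace.forall_mem_dualAnnihilator_apply_eq_zero_iff]
  intro l hl
  refine eq_zero_of_unitary (hE.algebraic w l) (fun u hu => ?_) g
  obtain ⟨k, hk⟩ := exists_kToGC_eq hconj hu
  have := hst k w hw
  rw [hτ, hk] at this
  exact (Submodule.mem_dualAnnihilator l).mp hl _ this

/-- The `K`-type with the highest weight of `F_a` restricted to `K` occurs exactly once, and its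
highest weight vector is extremal for `F_a`. -/
theorem IsKType.exists_embedding (hconj : ∀ z, ι₂ (ι₁.symm z) = star z) {T X : Type*}
    [AddCommGroup T] [Module ℂ T] [AddCommGroup X] [Module ℂ X]
    {τ : Representation ℂ (unitaryK ι₁ ι₂ n) T} {ρ : Representation ℂ (GC n) X} {a : Weight n}
    (hτ : IsKType ι₁ ι₂ τ a.toKWeight) (hρ : IsIrrepGC ρ a) :
    ∃ (f : T →ₗ[ℂ] X) (s : GLC n → T) (x : X), x ≠ 0 ∧
      (∀ b l : GLC n, IsUpperTriangular b → IsLowerTriangular l →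
        ρ (b, l) x = (borelChar a.left b * borelChar (fun i => a.right i.rev) l) • x) ∧
      (∀ g, f (s g) = ρ (twistedDiag n g) x) ∧
      (∀ k y, f (τ k y) = ρ (kToGC ι₁ ι₂ n k) (f y)) ∧
      ∀ f' : T →ₗ[ℂ] X, (∀ k y, f' (τ k y) = ρ (kToGC ι₁ ι₂ n k) (f' y)) → ∃ c : ℂ, f' = c • f := by
  obtain ⟨E, hE, hτE⟩ := hτ
  have := hρ.finiteDimensional
  obtain ⟨x, hx0, hx⟩ := hρ.exists_extremal
  obtain ⟨t, ht0, ht⟩ := hE.highestWeight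
  obtain ⟨A⟩ := exists_contravariantForm_GL hE
  obtain ⟨B⟩ := exists_contravariantForm ρ hρ.algebraic
  obtain ⟨f, hft, hf⟩ := exists_equivariant_of_highestWeight A
    (B.comp (twistedDiag n) star_twistedDiag) hE.irreducible hE.algebraic
    (fun v l => twistedDiag_mem_regularGL (hρ.algebraic v l)) ht0 ht (fun b hb => by
      rw [← borelChar_twistedDiag a hb]
      exact hx b _ hb hb.invTranspose)
  refine ⟨f, fun g => E g t, x, hx0, hx, fun g => ?_, fun k y => ?_, fun f' hf' => ?_⟩
  · rw [hf, hft]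
    rfl
  · rw [hτE, hf, kToGC_eq_twistedDiag k]
    rfl
  -- Density upgrades `K`-equivariance to the twisted diagonal; then `f' t` has the torus weight of
  -- `x`, so it is a multiple of `x`.
  · have hequiv : ∀ g y, f' (E g y) = ρ (twistedDiag n g) (f' y) := by
      intro g y
      rw [← sub_eq_zero, ← Module.forall_dual_apply_eq_zero_iff ℂ]
      intro l
      refine eq_zero_of_unitary (f := fun g => l (f' (E g y) - ρ (twistedDiag n g) (f' y)))
        ?_ (fun u hu => ?_) g
      · simp only [map_sub]
        exact Subalgebra.sub_mem _ (hE.algebraic y (l ∘ₗ f'))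
          (twistedDiag_mem_regularGL (hρ.algebraic (f' y) l))
      · obtain ⟨k, hk⟩ := exists_kToGC_eq hconj hu
        have := hf' k y
        rw [hτE, hk] at this
        change l (f' (E (twistedDiag n u).1 y) - ρ (twistedDiag n u) (f' y)) = 0
        rw [this, sub_self, map_zero]
    obtain ⟨c, hc⟩ := extremal_unique hρ (y := f' t) hx0 hx fun d => by
      rw [← hequiv, ht _ (isUpperTriangular_diagGL d), map_smul]
    refine ⟨c, LinearMap.ext fun y => ?_⟩
    have hy : y ∈ Submodule.span ℂ (Set.range fun g => E g t) :=
      span_orbit_eq_top hE.irreducible ht0 ▸ Submodule.mem_top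
    induction hy using Submodule.span_induction with
    | mem y hy =>
      obtain ⟨g, rfl⟩ := hy
      change f' (E g t) = c • f (E g t)
      rw [hequiv, hf, hc, hft, map_smul]
      rfl
    | zero => simp
    | add y z _ _ hy hz => simp only [map_add, hy, hz]
    | smul r y _ hy => simp only [map_smul, hy]

end CompactGroup

/-! ### Block embeddings of matrices -/

section Block

variable {n : ℕ} {m : Type*} [DecidableEq m]

/-- The matrix of the inclusion of coordinates given by `e`. -/
def coordInclusion (e : m → Fin n) : Matrix (Fin n) m ℂ :=
  Matrix.of fun p a => if p = e a then 1 else 0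

theorem coordInclusion_transpose_mul {e : m → Fin n} (he : Function.Injective e) :
    (coordInclusion e)ᵀ * coordInclusion e = 1 := by
  ext a b
  simp [coordInclusion, Matrix.mul_apply, Matrix.one_apply, he.eq_iff, eq_comm]

variable [Fintype m]

/-- The embedding of `m × m` matrices that acts trivially on the coordinates outside the image
of `e`. -/
def blockHom {e : m → Fin n} (he : Function.Injective e) :
    Matrix m m ℂ →* Matrix (Fin n) (Fin n) ℂ where
  toFun A := 1 + coordInclusion e * (A - 1) * (coordInclusion e)ᵀ
  map_one' := by simp
  map_mul' A B := by
    have h : coordInclusion e * (A - 1) * (coordInclusion e)ᵀ *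
        (coordInclusion e * (B - 1) * (coordInclusion e)ᵀ) =
          coordInclusion e * ((A - 1) * (B - 1)) * (coordInclusion e)ᵀ := by
      rw [Matrix.mul_assoc _ _ (_ * _ * _), ← Matrix.mul_assoc _ (_ * _), ← Matrix.mul_assoc _ _ (B - 1),
        coordInclusion_transpose_mul he, Matrix.one_mul]
      simp only [Matrix.mul_assoc]
    rw [add_mul, one_mul, mul_add, mul_one, h]
    have h2 : A * B - 1 = (A - 1) + (B - 1) + (A - 1) * (B - 1) := by noncomm_ring
    rw [h2, Matrix.mul_add, Matrix.mul_add, Matrix.add_mul, Matrix.add_mul]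
    abel

theorem blockHom_def {e : m → Fin n} (he : Function.Injective e) (A : Matrix m m ℂ) :
    blockHom he A = 1 + coordInclusion e * (A - 1) * (coordInclusion e)ᵀ := rfl

theorem det_blockHom {e : m → Fin n} (he : Function.Injective e) (A : Matrix m m ℂ) :
    (blockHom he A).det = A.det := by
  rw [blockHom_def, Matrix.mul_assoc, Matrix.det_one_add_mul_comm, Matrix.mul_assoc,
    coordInclusion_transpose_mul he, Matrix.mul_one, add_sub_cancel]

theorem blockHom_apply {e : m → Fin n} (he : Function.Injective e) (A : Matrix m m ℂ) (p q : Fin n) :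
    blockHom he A p q = (1 : Matrix (Fin n) (Fin n) ℂ) p q +
      ∑ b, ∑ a, if p = e a ∧ q = e b then (A - 1) a b else 0 := by
  simp only [blockHom_def, Matrix.add_apply, Matrix.mul_apply, coordInclusion, Matrix.of_apply,
    Matrix.transpose_apply]
  congr 1
  refine Finset.sum_congr rfl fun b _ => ?_
  rw [Finset.sum_mul]
  refine Finset.sum_congr rfl fun a _ => ?_
  by_cases h₁ : p = e a <;> by_cases h₂ : q = e b <;> simp [h₁, h₂]

theorem blockHom_apply_of_range {e : m → Fin n} (he : Function.Injective e) (A : Matrix m m ℂ)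
    (a b : m) : blockHom he A (e a) (e b) = A a b := by
  rw [blockHom_apply]
  simp only [he.eq_iff]
  rw [Finset.sum_eq_single b (fun b' _ h => by simp [h.symm]) (by simp),
    Finset.sum_eq_single a (fun a' _ h => by simp [h.symm]) (by simp)]
  simp [Matrix.one_apply, he.eq_iff]

theorem blockHom_apply_of_notMem_left {e : m → Fin n} (he : Function.Injective e)
    (A : Matrix m m ℂ) {p : Fin n} (hp : p ∉ Set.range e) (q : Fin n) :
    blockHom he A p q = (1 : Matrix (Fin n) (Fin n) ℂ) p q := by
  rw [blockHom_apply]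
  have : ∀ a, p ≠ e a := fun a h => hp ⟨a, h.symm⟩
  simp [this]

theorem blockHom_apply_of_notMem_right {e : m → Fin n} (he : Function.Injective e)
    (A : Matrix m m ℂ) (p : Fin n) {q : Fin n} (hq : q ∉ Set.range e) :
    blockHom he A p q = (1 : Matrix (Fin n) (Fin n) ℂ) p q := by
  rw [blockHom_apply]
  have : ∀ a, q ≠ e a := fun a h => hq ⟨a, h.symm⟩
  simp [this]

/-- The induced embedding of general linear groups. -/
def blockGL {e : m → Fin n} (he : Function.Injective e) :
    Matrix.GeneralLinearGroup m ℂ →* GLC n := Units.map (blockHom he)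

theorem coe_blockGL {e : m → Fin n} (he : Function.Injective e)
    (A : Matrix.GeneralLinearGroup m ℂ) :
    (blockGL he A : Matrix (Fin n) (Fin n) ℂ) = blockHom he A := rfl

end Block

/-! ### Stabilizers of highest weight lines -/

section Parabolic

variable {n : ℕ} {V : Type*} [AddCommGroup V] [Module ℂ V]

theorem injective_pair {i k : Fin n} (hik : i < k) : Function.Injective ![i, k] := by
  intro a b h
  fin_cases a <;> fin_cases b <;> simp_all [hik.ne, hik.ne']

theorem isUpperTriangular_blockGL {i k : Fin n} (hik : i < k)
    (A : Matrix.GeneralLinearGroup (Fin 2) ℂ) (hA : A.val 1 0 = 0) :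
    IsUpperTriangular (blockGL (injective_pair hik) A) := by
  intro p q hqp
  rw [coe_blockGL, blockHom_apply]
  simp only [Fin.sum_univ_two, Matrix.one_apply, hqp.ne', if_false, zero_add]
  have h1 : ¬ (p = i ∧ q = k) := fun h => absurd hqp (by rw [h.1, h.2]; exact not_lt.mpr hik.le)
  have h2 : ∀ r : Fin n, ¬ (p = r ∧ q = r) := fun r h => hqp.ne (h.2.trans h.1.symm)
  simp [h1, h2, hA]

theorem borelChar_blockGL {i k : Fin n} (hik : i < k) {c : Fin n → ℤ} (hc : c i = c k)
    (A : Matrix.GeneralLinearGroup (Fin 2) ℂ) (hA : A.val 0 0 * A.val 1 1 = 1) :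
    borelChar c (blockGL (injective_pair hik) A) = 1 := by
  rw [borelChar, Finset.prod_eq_mul i k hik.ne]
  · have h0 := blockHom_apply_of_range (injective_pair hik) A.val 0 0
    have h1 := blockHom_apply_of_range (injective_pair hik) A.val 1 1
    simp only [Matrix.cons_val_zero, Matrix.cons_val_one] at h0 h1
    rw [coe_blockGL, h0, h1, hc, ← mul_zpow, hA, one_zpow]
  · intro p _ hp
    rw [coe_blockGL, blockHom_apply_of_notMem_left]
    · simp
    · rintro ⟨a, rfl⟩
      fin_cases a <;> simp at hp
  · simp
  · simp

/-- A highest weight vector is fixed by the lower root groups on which its weight is trivial. -/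
theorem lower_transvection_fix [FiniteDimensional ℂ V] {σ : Representation ℂ (GLC n) V}
    (hσ : ∀ (v : V) (l : Module.Dual ℂ V), (fun g => l (σ g v)) ∈ regularGL n) {c : Fin n → ℤ}
    {v : V} (hv : ∀ b, IsUpperTriangular b → σ b v = borelChar c b • v) {i k : Fin n}
    (hik : i < k) (hc : c i = c k) (t : ℂ) {g : GLC n}
    (hg : (g : Matrix (Fin n) (Fin n) ℂ) = Matrix.transvection k i t) : σ g v = v := by
  let φ := blockGL (injective_pair hik)
  let L : ℂ → Matrix.GeneralLinearGroup (Fin 2) ℂ := fun t =>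
    Matrix.GeneralLinearGroup.mkOfDetNeZero !![1, 0; t, 1] (by simp)
  let U : ℂ → Matrix.GeneralLinearGroup (Fin 2) ℂ := fun s =>
    Matrix.GeneralLinearGroup.mkOfDetNeZero !![1, s; 0, 1] (by simp)
  have hentry : ∀ (A : ℂ → Matrix.GeneralLinearGroup (Fin 2) ℂ),
      (∀ a b, Differentiable ℂ fun t => (A t).val a b) → ∀ p q,
        Differentiable ℂ fun t => (φ (A t) : Matrix (Fin n) (Fin n) ℂ) p q := by
    intro A hA p q
    simp only [φ, coe_blockGL, blockHom_apply]
    refine (differentiable_const _).add (Differentiable.fun_sum fun b _ =>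
      Differentiable.fun_sum fun a _ => ?_)
    by_cases h : p = ![i, k] a ∧ q = ![i, k] b
    · simp only [h, and_self, if_true]
      exact (hA a b).sub_const _
    · simp only [h, if_false]
      exact differentiable_const _
  have hL : ∀ a b, Differentiable ℂ fun t => (L t).val a b := by
    intro a b
    change Differentiable ℂ fun t => (!![1, 0; t, 1] : Matrix _ _ ℂ) a b
    fin_cases a <;> fin_cases b <;> simp
  have hU : ∀ a b, Differentiable ℂ fun t => (U t).val a b := by
    intro a b
    change Differentiable ℂ fun t => (!![1, t; 0, 1] : Matrix _ _ ℂ) a b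
    fin_cases a <;> fin_cases b <;> simp
  have hgL : g = φ (L t) := by
    apply Units.ext
    rw [hg]
    simp only [φ, coe_blockGL]
    ext p q
    rw [blockHom_apply]
    simp [L, Matrix.transvection, Fin.sum_univ_two, Matrix.one_apply, Matrix.single_apply, eq_comm]
  let M := L 1 * U (-1)
  -- The upper triangular `D` has diagonal `(t, t⁻¹)` and fixes `v` as `c i = c k`. The remaining
  -- dependence on `t` is through `t⁻¹`, so the orbit map has a limit as `t → ∞`.
  have hfac : ∀ t : ℂ, t ≠ 0 → σ (φ (L t)) v = σ (φ (U (t⁻¹ - 1))) (σ (φ M) v) := by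
    intro t ht
    let D : Matrix.GeneralLinearGroup (Fin 2) ℂ :=
      Matrix.GeneralLinearGroup.mkOfDetNeZero !![t, 1; 0, t⁻¹] (by simp [ht])
    have hD : σ (φ D) v = v := by
      rw [hv _ (isUpperTriangular_blockGL hik D rfl),
        borelChar_blockGL hik hc D (mul_inv_cancel₀ ht), one_smul]
    have e : L t = U (t⁻¹ - 1) * M * D := by
      apply Units.ext
      change !![1, 0; t, 1] = !![1, t⁻¹ - 1; 0, 1] * (!![1, 0; 1, 1] * !![1, -1; 0, 1]) *
        !![t, 1; 0, t⁻¹]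
      ext a b
      fin_cases a <;> fin_cases b <;>
        (simp [Matrix.mul_apply, Fin.sum_univ_two]; try field_simp)
    rw [e, map_mul, map_mul, map_mul, map_mul, Module.End.mul_apply, Module.End.mul_apply, hD]
  rw [hgL, ← sub_eq_zero, ← Module.forall_dual_apply_eq_zero_iff ℂ]
  intro l
  have hd : Differentiable ℂ fun t => l (σ (φ (L t)) v) :=
    differentiable_regularGL _ (hentry L hL) (hσ v l)
  have hd' : Continuous fun s => l (σ (φ (U s)) (σ (φ M) v)) :=
    (differentiable_regularGL _ (hentry U hU) (hσ _ l)).continuous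
  have hlim : Filter.Tendsto (fun t => l (σ (φ (L t)) v)) (Filter.cocompact ℂ)
      (nhds (l (σ (φ (U (0 - 1))) (σ (φ M) v)))) := by
    have h1 : Filter.Tendsto (fun t : ℂ => t⁻¹ - 1) (Filter.cocompact ℂ) (nhds (0 - 1)) := by
      rw [← Metric.cobounded_eq_cocompact]
      exact Filter.tendsto_inv₀_cobounded.sub_const 1
    refine ((hd'.tendsto _).comp h1).congr' ?_
    have h2 : ∀ᶠ t : ℂ in Filter.cocompact ℂ, t ≠ 0 :=
      (isCompact_singleton (x := (0 : ℂ))).compl_mem_cocompact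
    filter_upwards [h2] with t ht
    rw [hfac t ht]
    rfl
  -- Liouville: an entire function with a finite limit at infinity is constant, here equal to its
  -- value at `t = 0`.
  have e1 := hd.apply_eq_of_tendsto_cocompact t hlim
  have e0 := hd.apply_eq_of_tendsto_cocompact 0 hlim
  have hL0 : L 0 = 1 := by
    apply Units.ext
    change !![1, 0; 0, 1] = _
    exact Matrix.one_fin_two.symm
  rw [hL0, map_one, map_one, Module.End.one_apply] at e0
  rw [map_sub, e1, e0, sub_self]

/-- A highest weight vector of weight `(m + k, k, …, k)` is an eigenvector of the stabilizer of the
first basis vector. -/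
theorem exists_eigenvalue_of_first_column [NeZero n] [FiniteDimensional ℂ V]
    {σ : Representation ℂ (GLC n) V}
    (hσ : ∀ (v : V) (l : Module.Dual ℂ V), (fun g => l (σ g v)) ∈ regularGL n) {c : Fin n → ℤ}
    {v : V} (hv : ∀ b, IsUpperTriangular b → σ b v = borelChar c b • v)
    (hc : ∀ i k : Fin n, i ≠ 0 → k ≠ 0 → c i = c k) {p : GLC n}
    (hp : ∀ i, (p : Matrix (Fin n) (Fin n) ℂ) i 0 = if i = 0 then 1 else 0) :
    ∃ r : ℂ, σ p v = r • v := by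
  let m := {i : Fin n // i ≠ 0}
  have he : Function.Injective (Subtype.val : m → Fin n) := Subtype.val_injective
  -- Diagonal matrices and transvections generate the block on the indices other than `0`; lower
  -- transvections fix `v` because its weight is constant on these indices.
  have key : ∀ A : Matrix m m ℂ, A.det ≠ 0 → ∀ g : GLC n,
      (g : Matrix (Fin n) (Fin n) ℂ) = blockHom he A → ∃ r : ℂ, σ g v = r • v := by
    intro A hA
    refine Matrix.diagonal_transvection_induction_of_det_ne_zero (fun A => ∀ g : GLC n,
      (g : Matrix (Fin n) (Fin n) ℂ) = blockHom he A → ∃ r : ℂ, σ g v = r • v) A hA ?_ ?_ ?_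
    · intro D _ g hg
      refine ⟨_, hv g fun i k hik => ?_⟩
      rw [hg, blockHom_apply]
      have : ∀ a b : m, ¬ ((i = a ∧ k = b) ∧ a = b) := by
        rintro a b ⟨⟨h1, h2⟩, h3⟩
        exact hik.ne (by rw [h1, h2, h3])
      rw [Matrix.one_apply_ne hik.ne', zero_add]
      refine Finset.sum_eq_zero fun b _ => Finset.sum_eq_zero fun a _ => ?_
      by_cases h : i = a.1 ∧ k = b.1
      · have hab : a ≠ b := fun h' => this a b ⟨h, h'⟩
        simp [Matrix.diagonal_apply_ne _ hab, Matrix.one_apply_ne hab]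
      · rw [if_neg h]
    · intro t g hg
      have hg' : (g : Matrix (Fin n) (Fin n) ℂ) = Matrix.transvection t.i.1 t.j.1 t.c := by
        rw [hg]
        ext p q
        rw [blockHom_apply, Matrix.TransvectionStruct.toMatrix, Matrix.transvection,
          Matrix.transvection, add_sub_cancel_left, Matrix.add_apply]
        congr 1
        rw [Finset.sum_eq_single t.j (fun b _ hb => Finset.sum_eq_zero fun a _ => by
          simp [hb.symm]) (by simp), Finset.sum_eq_single t.i
          (fun a _ ha => by simp [ha.symm]) (by simp)]
        simp [Matrix.single_apply, eq_comm]
      rcases lt_or_gt_of_ne (he.ne t.hij) with h | h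
      · refine ⟨_, hv g fun i k hik => ?_⟩
        rw [hg', Matrix.transvection, Matrix.add_apply, Matrix.one_apply_ne hik.ne',
          Matrix.single_apply, if_neg, add_zero]
        rintro ⟨rfl, rfl⟩
        exact absurd h (not_lt.mpr hik.le)
      · exact ⟨1, by
          rw [one_smul]
          exact lower_transvection_fix hσ hv h (hc _ _ t.j.2 t.i.2) t.c hg'⟩
    · intro A B hA hB ihA ihB g hg
      let gA : GLC n := Matrix.GeneralLinearGroup.mkOfDetNeZero (blockHom he A)
        (by rwa [det_blockHom])
      let gB : GLC n := Matrix.GeneralLinearGroup.mkOfDetNeZero (blockHom he B)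
        (by rwa [det_blockHom])
      obtain ⟨rA, hrA⟩ := ihA gA rfl
      obtain ⟨rB, hrB⟩ := ihB gB rfl
      have : g = gA * gB := by
        apply Units.ext
        rw [hg, map_mul]
        rfl
      refine ⟨rB * rA, ?_⟩
      rw [this, map_mul, Module.End.mul_apply, hrB, map_smul, hrA, smul_smul]
  -- A matrix whose first column is the first basis vector is the product of its lower right block
  -- and an upper unipotent matrix `u` carrying its first row.
  let P : Matrix (Fin n) (Fin n) ℂ := p.val
  let A : Matrix m m ℂ := P.submatrix Subtype.val Subtype.val
  let u : Matrix (Fin n) (Fin n) ℂ := Matrix.of fun k j =>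
    if k = 0 then P 0 j else if k = j then 1 else 0
  have hu : u.BlockTriangular id := by
    intro i k (hik : k < i)
    have : i ≠ 0 := by rintro rfl; simp at hik
    simp [u, this, hik.ne']
  have hu1 : u.det = 1 := by
    rw [Matrix.det_of_isUpperTriangular hu]
    refine Finset.prod_eq_one fun i _ => ?_
    by_cases h : i = 0
    · simp [u, h, P, hp]
    · simp [u, h]
  have hA : ∀ i k, blockHom he A i k = if i = 0 ∨ k = 0 then (1 : Matrix (Fin n) (Fin n) ℂ) i k
      else P i k := by
    intro i k
    by_cases hi : i = 0
    · rw [blockHom_apply_of_notMem_left he A (by simp [hi]), if_pos (Or.inl hi)]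
    by_cases hk : k = 0
    · rw [blockHom_apply_of_notMem_right he A i (by simp [hk]), if_pos (Or.inr hk)]
    rw [if_neg (by tauto)]
    exact blockHom_apply_of_range he A ⟨i, hi⟩ ⟨k, hk⟩
  have hfac : P = blockHom he A * u := by
    ext i j
    rw [Matrix.mul_apply]
    by_cases hi : i = 0
    · subst hi
      rw [Finset.sum_eq_single 0 (fun k _ hk => by simp [hA, Matrix.one_apply_ne hk.symm]) (by simp)]
      simp [hA, u]
    · by_cases hj : j = 0
      · subst hj
        symm
        rw [show P i 0 = 0 by simp [P, hp, hi]]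
        refine Finset.sum_eq_zero fun k _ => ?_
        by_cases hk : k = 0
        · simp [hA, hk, hi]
        · simp [u, hk]
      · rw [Finset.sum_eq_single j]
        · simp [hA, hi, hj, u]
        · intro k _ hk
          by_cases hk0 : k = 0
          · simp [hA, hk0, hi]
          · simp [u, hk, hk0]
        · simp
  have hdet : A.det ≠ 0 := by
    have h := (Matrix.isUnits_det_units p).ne_zero
    change P.det ≠ 0 at h
    rwa [hfac, Matrix.det_mul, hu1, mul_one, det_blockHom] at h
  let g : GLC n := Matrix.GeneralLinearGroup.mkOfDetNeZero (blockHom he A) (by rwa [det_blockHom])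
  let ug : GLC n := Matrix.GeneralLinearGroup.mkOfDetNeZero u (by rw [hu1]; exact one_ne_zero)
  have hpg : p = g * ug := Units.ext hfac
  obtain ⟨r, hr⟩ := key A hdet g rfl
  refine ⟨borelChar c ug * r, ?_⟩
  rw [hpg, map_mul, Module.End.mul_apply, hv ug (fun i k hik => hu hik), map_smul, hr, smul_smul]

end Parabolic

/-! ### Invariant functionals on triple products and the open orbit -/

section TripleProducts

variable {n : ℕ}

/-- The domain property of `GL_n`, applied in one variable at a time. -/
theorem exists_both_ne_zero₃ {A B : GLC n → GLC n → GLC n → ℂ}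
    (hA₁ : ∀ g₂ g₃, (fun g => A g g₂ g₃) ∈ regularGL n)
    (hA₂ : ∀ g₁ g₃, (fun g => A g₁ g g₃) ∈ regularGL n)
    (hA₃ : ∀ g₁ g₂, (fun g => A g₁ g₂ g) ∈ regularGL n)
    (hB₁ : ∀ g₂ g₃, (fun g => B g g₂ g₃) ∈ regularGL n)
    (hB₂ : ∀ g₁ g₃, (fun g => B g₁ g g₃) ∈ regularGL n)
    (hB₃ : ∀ g₁ g₂, (fun g => B g₁ g₂ g) ∈ regularGL n)
    {a₁ a₂ a₃ b₁ b₂ b₃ : GLC n} (ha : A a₁ a₂ a₃ ≠ 0) (hb : B b₁ b₂ b₃ ≠ 0) :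
    ∃ g₁ g₂ g₃, A g₁ g₂ g₃ ≠ 0 ∧ B g₁ g₂ g₃ ≠ 0 := by
  obtain ⟨g₁, h₁, h₁'⟩ := exists_both_ne_zero (hA₁ a₂ a₃) (hB₁ b₂ b₃) ha hb
  obtain ⟨g₂, h₂, h₂'⟩ := exists_both_ne_zero (hA₂ g₁ a₃) (hB₂ g₁ b₃) h₁ h₁'
  obtain ⟨g₃, h₃, h₃'⟩ := exists_both_ne_zero (hA₃ g₁ g₂) (hB₃ g₁ g₂) h₂ h₂'
  exact ⟨g₁, g₂, g₃, h₃, h₃'⟩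

/-- An invertible matrix whose first column is `(1, …, 1)`. -/
def onesColumn (n : ℕ) [NeZero n] : GLC n :=
  Matrix.GeneralLinearGroup.mkOfDetNeZero
    (Matrix.of fun i j : Fin n => if j = 0 ∨ i = j then (1 : ℂ) else 0) (by
      rw [Matrix.det_of_isLowerTriangular]
      · simp
      · intro i j (hij : i < j)
        have : j ≠ 0 := by rintro rfl; simp at hij
        simp [this, hij.ne])

theorem onesColumn_apply [NeZero n] (i : Fin n) :
    (onesColumn n : Matrix (Fin n) (Fin n) ℂ) i 0 = 1 := by
  simp [onesColumn, Matrix.GeneralLinearGroup.mkOfDetNeZero]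

theorem eq_zero_of_first_column_ne_zero [NeZero n] {f : GLC n → ℂ} (hf : f ∈ regularGL n)
    (h : ∀ g : GLC n, (∀ i, (g : Matrix (Fin n) (Fin n) ℂ) i 0 ≠ 0) → f g = 0) (g : GLC n) :
    f g = 0 := by
  by_contra hg
  have hprod : (∏ i, fun g : GLC n => (g : Matrix (Fin n) (Fin n) ℂ) i 0) ∈ regularGL n :=
    Subalgebra.prod_mem _ fun i _ => coord_mem_regularGL i 0
  obtain ⟨g', h₁, h₂⟩ := exists_both_ne_zero hf hprod hg (b := onesColumn n) (by
    simp [onesColumn_apply])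
  refine h₁ (h g' fun i hi => h₂ ?_)
  rw [Finset.prod_apply]
  exact Finset.prod_eq_zero (Finset.mem_univ i) hi

/-- The group `GL_n` has an open orbit on the product of two flag varieties and the projective
space, so that an equivariant function is determined by one value. -/
theorem eq_zero_of_openOrbit [NeZero n] {F : GLC n → GLC n → GLC n → ℂ}
    (hinv : ∀ g g₁ g₂ g₃, F (g * g₁) (g * g₂) (g * g₃) = F g₁ g₂ g₃)
    (h₁ : ∀ b, IsUpperTriangular b → ∃ r : ℂ, ∀ g₁ g₂ g₃, F (g₁ * b) g₂ g₃ = r * F g₁ g₂ g₃)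
    (h₂ : ∀ l, IsLowerTriangular l → ∃ r : ℂ, ∀ g₁ g₂ g₃, F g₁ (g₂ * l) g₃ = r * F g₁ g₂ g₃)
    (h₃ : ∀ p : GLC n, (∀ i, (p : Matrix (Fin n) (Fin n) ℂ) i 0 = if i = 0 then 1 else 0) →
      ∃ r : ℂ, ∀ g₁ g₂ g₃, F g₁ g₂ (g₃ * p) = r * F g₁ g₂ g₃)
    (r₂ : ∀ g₁ g₃, (fun g => F g₁ g g₃) ∈ regularGL n)
    (r₃ : ∀ g₁ g₂, (fun g => F g₁ g₂ g) ∈ regularGL n)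
    (h0 : F 1 1 (onesColumn n) = 0) (g₁ g₂ g₃ : GLC n) : F g₁ g₂ g₃ = 0 := by
  -- The torus lies in both Borel subgroups, so it fixes the two base flags while moving `(1, …, 1)`
  -- to every vector with nonzero coordinates.
  have hT : ∀ x, F 1 1 (diagGL x * onesColumn n) = 0 := by
    intro x
    have hu := (isUpperTriangular_diagGL x).inv
    have hl := (isLowerTriangular_diagGL x).inv
    obtain ⟨r, hr⟩ := h₁ _ hu
    obtain ⟨r', hr'⟩ := h₂ _ hl
    have := hinv (diagGL x)⁻¹ 1 1 (diagGL x * onesColumn n)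
    have e := hr 1 (diagGL x)⁻¹ (onesColumn n)
    have e' := hr' 1 1 (onesColumn n)
    rw [one_mul] at e e'
    rw [← this, inv_mul_cancel_left, mul_one, e, e', h0, mul_zero, mul_zero]
  -- The first column of `g` determines its coset modulo the stabilizer of the first basis vector,
  -- and generic columns have no zero entry.
  have hP : ∀ g, F 1 1 g = 0 := by
    refine eq_zero_of_first_column_ne_zero (r₃ 1 1) fun g hg => ?_
    let x : Fin n → ℂˣ := fun i => Units.mk0 _ (hg i)
    let y := diagGL x * onesColumn n
    have hy : ∀ i, (y : Matrix (Fin n) (Fin n) ℂ) i 0 = (g : Matrix (Fin n) (Fin n) ℂ) i 0 := by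
      intro i
      rw [Units.val_mul, coe_diagGL, Matrix.diagonal_mul, onesColumn_apply, mul_one]
      rfl
    obtain ⟨r, hr⟩ := h₃ (y⁻¹ * g) fun i => by
      have : ((y⁻¹ * g : GLC n) : Matrix (Fin n) (Fin n) ℂ) i 0 =
          ((y⁻¹ * y : GLC n) : Matrix (Fin n) (Fin n) ℂ) i 0 := by
        simp only [Units.val_mul, Matrix.mul_apply, hy]
      rw [this, inv_mul_cancel, Units.val_one, Matrix.one_apply]
    have := hr 1 1 y
    rwa [mul_inv_cancel_left, hT, mul_zero] at this
  -- For generic `g = b⁻¹ l⁻¹` the factor `l⁻¹` is absorbed on the right, and translating by `b`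
  -- returns the pair of flags to the base point.
  have hQ : ∀ g g₃, F 1 g g₃ = 0 := by
    intro g g₃
    have := eq_zero_of_bigCell (inv_mem_regularGL (r₂ 1 g₃)) (fun l b hl hb => ?_) g⁻¹
    · simpa using this
    · obtain ⟨r, hr⟩ := h₂ _ hl.inv
      obtain ⟨r', hr'⟩ := h₁ _ hb
      rw [mul_inv_rev, hr]
      have e := hinv b 1 b⁻¹ g₃
      have e' := hr' 1 1 (b * g₃)
      rw [one_mul] at e'
      rw [mul_one, mul_inv_cancel, e', hP, mul_zero] at e
      rw [← e, mul_zero]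
  have := hinv g₁⁻¹ g₁ g₂ g₃
  rw [inv_mul_cancel, hQ] at this
  exact this.symm

variable {X Y Z : Type*} [AddCommGroup X] [Module ℂ X] [AddCommGroup Y] [Module ℂ Y]
  [AddCommGroup Z] [Module ℂ Z]

/-- The orbit of a nonzero vector spans each irreducible factor, so tensors of orbit vectors span
the product. -/
theorem exists_tmul_orbit_ne_zero {G : Type*} [Group G] {ρ₁ : Representation ℂ G X}
    {ρ₂ : Representation ℂ G Y} {ρ₃ : Representation ℂ G Z} (h₁ : ρ₁.IsIrreducible)
    (h₂ : ρ₂.IsIrreducible) (h₃ : ρ₃.IsIrreducible) {x : X} {y : Y} {z : Z} (hx : x ≠ 0)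
    (hy : y ≠ 0) (hz : z ≠ 0) {φ : X ⊗[ℂ] (Y ⊗[ℂ] Z) →ₗ[ℂ] ℂ} (hφ : φ ≠ 0) :
    ∃ g₁ g₂ g₃, φ (ρ₁ g₁ x ⊗ₜ (ρ₂ g₂ y ⊗ₜ ρ₃ g₃ z)) ≠ 0 := by
  by_contra! h
  refine hφ (TensorProduct.ext ?_)
  refine LinearMap.ext_on_range (span_orbit_eq_top h₁ hx) fun g₁ => ?_
  refine TensorProduct.ext ?_
  refine LinearMap.ext_on_range (span_orbit_eq_top h₂ hy) fun g₂ => ?_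
  refine LinearMap.ext_on_range (span_orbit_eq_top h₃ hz) fun g₃ => ?_
  exact h g₁ g₂ g₃

/-- An invariant functional on a triple product that is multiplicity free on the left factor of
`GL_n × GL_n` does not vanish on the orbit of the twisted diagonal. -/
theorem exists_twistedDiag_ne_zero [NeZero n] {ρ₁ : Representation ℂ (GC n) X}
    {ρ₂ : Representation ℂ (GC n) Y} {ρ₃ : Representation ℂ (GC n) Z}
    (alg₁ : ∀ v (l : Module.Dual ℂ X), (fun g => l (ρ₁ g v)) ∈ regularGC n)
    (alg₂ : ∀ v (l : Module.Dual ℂ Y), (fun g => l (ρ₂ g v)) ∈ regularGC n)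
    (alg₃ : ∀ v (l : Module.Dual ℂ Z), (fun g => l (ρ₃ g v)) ∈ regularGC n)
    (φ : X ⊗[ℂ] (Y ⊗[ℂ] Z) →ₗ[ℂ] ℂ)
    (hφ : ∀ g x y z, φ (ρ₁ g x ⊗ₜ (ρ₂ g y ⊗ₜ ρ₃ g z)) = φ (x ⊗ₜ (y ⊗ₜ z)))
    {x : X} {y : Y} {z : Z} {γ₁ γ₂ γ₃ : GLC n}
    (hx : ∀ b, IsUpperTriangular b → ∃ r : ℂ, ρ₁ (b, 1) (ρ₁ (γ₁, 1) x) = r • ρ₁ (γ₁, 1) x)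
    (hy : ∀ l, IsLowerTriangular l → ∃ r : ℂ, ρ₂ (l, 1) (ρ₂ (γ₂, 1) y) = r • ρ₂ (γ₂, 1) y)
    (hz : ∀ p : GLC n, (∀ i, (p : Matrix (Fin n) (Fin n) ℂ) i 0 = if i = 0 then 1 else 0) →
      ∃ r : ℂ, ρ₃ (p, 1) (ρ₃ (γ₃, 1) z) = r • ρ₃ (γ₃, 1) z)
    (hne : ∃ g₁ g₂ g₃, φ (ρ₁ g₁ x ⊗ₜ (ρ₂ g₂ y ⊗ₜ ρ₃ g₃ z)) ≠ 0) :
    ∃ g₁ g₂ g₃, φ (ρ₁ (twistedDiag n g₁) x ⊗ₜ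
      (ρ₂ (twistedDiag n g₂) y ⊗ₜ ρ₃ (twistedDiag n g₃) z)) ≠ 0 := by
  -- The variables of the two factors are separated: `g_i` acts through the left one, `h_i` through
  -- the right one. The `γ_i` move the vectors to eigenvectors of the three subgroups.
  let Ψ : GLC n → GLC n → GLC n → GLC n → GLC n → GLC n → ℂ := fun h₁ h₂ h₃ g₁ g₂ g₃ =>
    φ (ρ₁ (g₁, h₁) (ρ₁ (γ₁, 1) x) ⊗ₜ (ρ₂ (g₂, h₂) (ρ₂ (γ₂, 1) y) ⊗ₜ
      ρ₃ (g₃, h₃) (ρ₃ (γ₃, 1) z)))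
  have reg₁ : ∀ b c, (fun a => φ (ρ₁ a (ρ₁ (γ₁, 1) x) ⊗ₜ (b ⊗ₜ c))) ∈ regularGC n := fun b c =>
    alg₁ (ρ₁ (γ₁, 1) x) (φ ∘ₗ (TensorProduct.mk ℂ _ _).flip (b ⊗ₜ c))
  have reg₂ : ∀ a c, (fun b => φ (a ⊗ₜ (ρ₂ b (ρ₂ (γ₂, 1) y) ⊗ₜ c))) ∈ regularGC n := fun a c =>
    alg₂ (ρ₂ (γ₂, 1) y) (φ ∘ₗ TensorProduct.mk ℂ _ _ a ∘ₗ (TensorProduct.mk ℂ _ _).flip c)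
  have reg₃ : ∀ a b, (fun c => φ (a ⊗ₜ (b ⊗ₜ ρ₃ c (ρ₃ (γ₃, 1) z)))) ∈ regularGC n := fun a b =>
    alg₃ (ρ₃ (γ₃, 1) z) (φ ∘ₗ TensorProduct.mk ℂ _ _ a ∘ₗ TensorProduct.mk ℂ _ _ b)
  have inv : ∀ h₁ h₂ h₃ g g₁ g₂ g₃,
      Ψ h₁ h₂ h₃ (g * g₁) (g * g₂) (g * g₃) = Ψ h₁ h₂ h₃ g₁ g₂ g₃ := by
    intro h₁ h₂ h₃ g g₁ g₂ g₃
    have e : ∀ a h : GLC n, ((g * a, h) : GC n) = (g, 1) * (a, h) := fun a h =>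
      Prod.ext rfl (one_mul h).symm
    simp only [Ψ, e, map_mul, Module.End.mul_apply]
    exact hφ _ _ _ _
  have split : ∀ a b h : GLC n, ((a * b, h) : GC n) = (a, h) * (b, 1) := fun a b h =>
    Prod.ext rfl (mul_one h).symm
  have eig₁ : ∀ b, IsUpperTriangular b → ∃ r : ℂ, ∀ h₁ h₂ h₃ g₁ g₂ g₃,
      Ψ h₁ h₂ h₃ (g₁ * b) g₂ g₃ = r * Ψ h₁ h₂ h₃ g₁ g₂ g₃ := by
    intro b hb
    obtain ⟨r, hr⟩ := hx b hb
    refine ⟨r, fun h₁ h₂ h₃ g₁ g₂ g₃ => ?_⟩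
    simp only [Ψ, split, map_mul, Module.End.mul_apply, hr, map_smul, ← TensorProduct.smul_tmul',
      smul_eq_mul]
  have eig₂ : ∀ b, IsLowerTriangular b → ∃ r : ℂ, ∀ h₁ h₂ h₃ g₁ g₂ g₃,
      Ψ h₁ h₂ h₃ g₁ (g₂ * b) g₃ = r * Ψ h₁ h₂ h₃ g₁ g₂ g₃ := by
    intro b hb
    obtain ⟨r, hr⟩ := hy b hb
    refine ⟨r, fun h₁ h₂ h₃ g₁ g₂ g₃ => ?_⟩
    simp only [Ψ, split, map_mul, Module.End.mul_apply, hr, map_smul, ← TensorProduct.smul_tmul',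
      TensorProduct.tmul_smul, smul_eq_mul]
  have eig₃ : ∀ p : GLC n, (∀ i, (p : Matrix (Fin n) (Fin n) ℂ) i 0 = if i = 0 then 1 else 0) →
      ∃ r : ℂ, ∀ h₁ h₂ h₃ g₁ g₂ g₃, Ψ h₁ h₂ h₃ g₁ g₂ (g₃ * p) = r * Ψ h₁ h₂ h₃ g₁ g₂ g₃ := by
    intro b hb
    obtain ⟨r, hr⟩ := hz b hb
    refine ⟨r, fun h₁ h₂ h₃ g₁ g₂ g₃ => ?_⟩
    simp only [Ψ, split, map_mul, Module.End.mul_apply, hr, map_smul, TensorProduct.tmul_smul,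
      smul_eq_mul]
  have regL₂ : ∀ h₁ h₂ h₃ g₁ g₃, (fun g => Ψ h₁ h₂ h₃ g₁ g g₃) ∈ regularGL n :=
    fun h₁ h₂ h₃ g₁ g₃ => left_mem_regularGL (reg₂ _ _) h₂
  have regL₃ : ∀ h₁ h₂ h₃ g₁ g₂, (fun g => Ψ h₁ h₂ h₃ g₁ g₂ g) ∈ regularGL n :=
    fun h₁ h₂ h₃ g₁ g₂ => left_mem_regularGL (reg₃ _ _) h₃
  obtain ⟨p₁, p₂, p₃, q₁, q₂, q₃, hpq⟩ : ∃ p₁ p₂ p₃ q₁ q₂ q₃, Ψ q₁ q₂ q₃ p₁ p₂ p₃ ≠ 0 := by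
    obtain ⟨g₁, g₂, g₃, h⟩ := hne
    refine ⟨g₁.1 * γ₁⁻¹, g₂.1 * γ₂⁻¹, g₃.1 * γ₃⁻¹, g₁.2, g₂.2, g₃.2, ?_⟩
    simpa only [Ψ, ← Module.End.mul_apply, ← map_mul, Prod.mk_mul_mk, inv_mul_cancel_right,
      mul_one] using h
  have hbase : Ψ q₁ q₂ q₃ 1 1 (onesColumn n) ≠ 0 := fun h0 => hpq <| by
    refine eq_zero_of_openOrbit (F := Ψ q₁ q₂ q₃) (inv _ _ _) (fun b hb => ?_) (fun b hb => ?_)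
      (fun b hb => ?_) (regL₂ _ _ _) (regL₃ _ _ _) h0 _ _ _
    · obtain ⟨r, hr⟩ := eig₁ b hb
      exact ⟨r, hr _ _ _⟩
    · obtain ⟨r, hr⟩ := eig₂ b hb
      exact ⟨r, hr _ _ _⟩
    · obtain ⟨r, hr⟩ := eig₃ b hb
      exact ⟨r, hr _ _ _⟩
  -- For fixed `h_i` both terms transform alike in the `g_i` and agree at the base point of the open
  -- orbit, so they coincide. Hence `Ψ` is a function of the `g_i` times a function of the `h_i`.
  have factor : ∀ h₁ h₂ h₃ g₁ g₂ g₃, Ψ q₁ q₂ q₃ 1 1 (onesColumn n) * Ψ h₁ h₂ h₃ g₁ g₂ g₃ -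
      Ψ h₁ h₂ h₃ 1 1 (onesColumn n) * Ψ q₁ q₂ q₃ g₁ g₂ g₃ = 0 := by
    intro h₁ h₂ h₃
    refine eq_zero_of_openOrbit (F := fun g₁ g₂ g₃ =>
      Ψ q₁ q₂ q₃ 1 1 (onesColumn n) * Ψ h₁ h₂ h₃ g₁ g₂ g₃ -
      Ψ h₁ h₂ h₃ 1 1 (onesColumn n) * Ψ q₁ q₂ q₃ g₁ g₂ g₃) (fun g g₁ g₂ g₃ => ?_)
      (fun b hb => ?_) (fun b hb => ?_) (fun b hb => ?_) (fun g₁ g₃ => ?_) (fun g₁ g₂ => ?_) ?_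
    · simp only [inv]
    · obtain ⟨r, hr⟩ := eig₁ b hb
      exact ⟨r, fun g₁ g₂ g₃ => by simp only [hr]; ring⟩
    · obtain ⟨r, hr⟩ := eig₂ b hb
      exact ⟨r, fun g₁ g₂ g₃ => by simp only [hr]; ring⟩
    · obtain ⟨r, hr⟩ := eig₃ b hb
      exact ⟨r, fun g₁ g₂ g₃ => by simp only [hr]; ring⟩
    · exact Subalgebra.sub_mem _
        (Subalgebra.mul_mem _ ((regularGL n).algebraMap_mem _) (regL₂ _ _ _ _ _))
        (Subalgebra.mul_mem _ ((regularGL n).algebraMap_mem _) (regL₂ _ _ _ _ _))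
    · exact Subalgebra.sub_mem _
        (Subalgebra.mul_mem _ ((regularGL n).algebraMap_mem _) (regL₃ _ _ _ _ _))
        (Subalgebra.mul_mem _ ((regularGL n).algebraMap_mem _) (regL₃ _ _ _ _ _))
    · ring
  -- The factor in the left variables is taken at `g_i γ_i⁻¹`, to undo the shift by `γ_i`, and the
  -- one in the right variables at `g_i⁻ᵗ`.
  obtain ⟨g₁, g₂, g₃, hA, hB⟩ := exists_both_ne_zero₃
    (A := fun g₁ g₂ g₃ => Ψ q₁ q₂ q₃ (g₁ * γ₁⁻¹) (g₂ * γ₂⁻¹) (g₃ * γ₃⁻¹))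
    (B := fun g₁ g₂ g₃ => Ψ (invTranspose g₁) (invTranspose g₂) (invTranspose g₃) 1 1
      (onesColumn n))
    (fun _ _ => mul_right_mem_regularGL γ₁⁻¹ (left_mem_regularGL (reg₁ _ _) q₁))
    (fun _ _ => mul_right_mem_regularGL γ₂⁻¹ (left_mem_regularGL (reg₂ _ _) q₂))
    (fun _ _ => mul_right_mem_regularGL γ₃⁻¹ (left_mem_regularGL (reg₃ _ _) q₃))
    (fun _ _ => invTranspose_mem_regularGL (right_mem_regularGL (reg₁ _ _) 1))
    (fun _ _ => invTranspose_mem_regularGL (right_mem_regularGL (reg₂ _ _) 1))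
    (fun _ _ => invTranspose_mem_regularGL (right_mem_regularGL (reg₃ _ _) (onesColumn n)))
    (a₁ := p₁ * γ₁) (a₂ := p₂ * γ₂) (a₃ := p₃ * γ₃) (b₁ := invTranspose q₁)
    (b₂ := invTranspose q₂) (b₃ := invTranspose q₃)
    (by simpa only [mul_inv_cancel_right] using hpq)
    (by simpa only [invTranspose_invTranspose] using hbase)
  refine ⟨g₁, g₂, g₃, fun h0 => ?_⟩
  have e := factor (invTranspose g₁) (invTranspose g₂) (invTranspose g₃) (g₁ * γ₁⁻¹) (g₂ * γ₂⁻¹)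
    (g₃ * γ₃⁻¹)
  have e2 : Ψ (invTranspose g₁) (invTranspose g₂) (invTranspose g₃) (g₁ * γ₁⁻¹) (g₂ * γ₂⁻¹)
      (g₃ * γ₃⁻¹) = 0 := by
    simpa only [Ψ, ← Module.End.mul_apply, ← map_mul, Prod.mk_mul_mk, inv_mul_cancel_right,
      mul_one, twistedDiag_apply] using h0
  rw [e2, mul_zero, zero_sub, neg_eq_zero] at e
  exact mul_ne_zero hB hA e

end TripleProducts

/-! ### Nonvanishing on the twisted diagonal for the weight of `V_j` -/

section Nonvanishing

variable {n : ℕ}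

/-- The lower bound on `j` makes the exponent of the left symmetric power nonnegative, so its
highest weight is supported at the first index. -/
theorem kEta_le_of_caseC {μ ν : Weight n} {w w' j : ℤ} (hn : n ≠ 0) (h : CaseC μ ν w w' j) :
    0 ≤ n * j + kEta μ ν - n := by
  have hn' : (0 : ℚ) < n := by positivity
  have h1 := h.1
  have h2 : (n : ℚ) * (1 - kEta μ ν / n) ≤ n * j := mul_le_mul_of_nonneg_left h1 hn'.le
  rw [mul_sub, mul_div_cancel₀ _ hn'.ne'] at h2
  have h3 : (0 : ℚ) ≤ n * j + kEta μ ν - n := by linarith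
  exact_mod_cast h3

theorem kEta_le_of_caseB {μ ν : Weight n} {w w' j : ℤ} (hn : n ≠ 0) (h : CaseB μ ν w w' j) :
    0 ≤ n * j - n - kEta μ ν + n * (w + w') := by
  have hn' : (0 : ℚ) < n := by positivity
  have h1 := h.1
  have h2 : (n : ℚ) * (1 - (w + w') + kEta μ ν / n) ≤ n * j := mul_le_mul_of_nonneg_left h1 hn'.le
  rw [mul_add, mul_div_cancel₀ _ hn'.ne'] at h2
  have h3 : (0 : ℚ) ≤ n * j - n - kEta μ ν + n * (w + w') := by linarith
  exact_mod_cast h3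

theorem symWeight_eq_zero [NeZero n] {a : ℤ} (ha : 0 ≤ a) {i : Fin n} (hi : i ≠ 0) :
    symWeight a i = 0 := by
  have : (i : ℕ) ≠ 0 := fun h => hi (Fin.ext (by simpa using h))
  simp [symWeight, ha, this]

/-- One of the two halves of the highest weight of `V_j` has the shape `(m + k, k, …, k)`. -/
theorem IsVWeight.almost_const [NeZero n] {μ ν a : Weight n} {w w' j : ℤ}
    (h : IsVWeight μ ν w w' j a) :
    (∀ i k : Fin n, i ≠ 0 → k ≠ 0 → a.left i = a.left k) ∨
      ∀ i k : Fin n, i ≠ 0 → k ≠ 0 → a.right i = a.right k := by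
  rcases h with ⟨h, rfl⟩ | ⟨h, rfl⟩
  · refine Or.inr fun i k hi hk => ?_
    simp [vWeightB, symWeight_eq_zero (kEta_le_of_caseB (NeZero.ne n) h), hi, hk]
  · refine Or.inl fun i k hi hk => ?_
    simp [vWeightC, symWeight_eq_zero (kEta_le_of_caseC (NeZero.ne n) h), hi, hk]

/-- `x` is an eigenvector of the product of the upper and the lower triangular group, with the
extremal weight `(a.left, w₀ a.right)`. -/
def IsExtremal {V : Type*} [AddCommGroup V] [Module ℂ V] (ρ : Representation ℂ (GC n) V)
    (a : Weight n) (x : V) : Prop :=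
  ∀ b l : GLC n, IsUpperTriangular b → IsLowerTriangular l →
    ρ (b, l) x = (borelChar a.left b * borelChar (fun i => a.right i.rev) l) • x

theorem IsExtremal.left {V : Type*} [AddCommGroup V] [Module ℂ V] {ρ : Representation ℂ (GC n) V}
    {a : Weight n} {x : V} (h : IsExtremal ρ a x) {b : GLC n} (hb : IsUpperTriangular b) :
    ρ (b, 1) x = borelChar a.left b • x := by
  rw [h b 1 hb fun i k hik => Matrix.one_apply_ne hik.ne]
  simp [borelChar]

/-- Interchanging the two factors of `GL_n × GL_n`. -/
def swapGC (n : ℕ) : GC n →* GC n := (MonoidHom.snd _ _).prod (MonoidHom.fst _ _)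

theorem swapGC_surjective : Function.Surjective (swapGC n) := fun g => ⟨(g.2, g.1), rfl⟩

theorem IsIrrepGC.swap {V : Type*} [AddCommGroup V] [Module ℂ V] {ρ : Representation ℂ (GC n) V}
    {a : Weight n} (h : IsIrrepGC ρ a) : IsIrrepGC (ρ.comp (swapGC n)) ⟨a.right, a.left⟩ where
  finiteDimensional := h.finiteDimensional
  algebraic v l := regularGC_comp _ (swapGC n) (fun _ hf => snd_mem_regularGC hf)
    (fun _ hf => comp_fst_mem_regularGC hf) (h.algebraic v l)
  irreducible := (isIrreducible_comp_iff ρ swapGC_surjective).mpr h.irreducible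
  highestWeight := by
    obtain ⟨v, hv, hb⟩ := h.highestWeight
    refine ⟨v, hv, fun b₁ b₂ h₁ h₂ => ?_⟩
    rw [mul_comm]
    exact hb b₂ b₁ h₂ h₁

/-- Interchanging the factors exchanges upper and lower triangular; the longest Weyl element in both
factors restores the order. -/
theorem IsExtremal.swap {V : Type*} [AddCommGroup V] [Module ℂ V] {ρ : Representation ℂ (GC n) V}
    {a : Weight n} {x : V} (h : IsExtremal ρ a x) :
    IsExtremal (ρ.comp (swapGC n)) ⟨a.right, a.left⟩ (ρ (weyl n, weyl n) x) := by
  intro b l hb hl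
  change ρ (l, b) (ρ (weyl n, weyl n) x) = _
  have e : ((l, b) * (weyl n, weyl n) : GC n) =
      (weyl n, weyl n) * (weyl n * l * weyl n, weyl n * b * weyl n) := by
    refine Prod.ext ?_ ?_ <;> simp only [Prod.fst_mul, Prod.snd_mul, ← mul_assoc, weyl_mul_self, one_mul]
  rw [← Module.End.mul_apply, ← map_mul, e, map_mul, Module.End.mul_apply,
    h _ _ hl.weyl_conj hb.weyl_conj, map_smul, borelChar_weyl_conj, borelChar_weyl_conj, mul_comm]
  simp only [Fin.rev_rev]

variable {X Y Z : Type*} [AddCommGroup X] [Module ℂ X] [AddCommGroup Y] [Module ℂ Y]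
  [AddCommGroup Z] [Module ℂ Z] {ρ₁ : Representation ℂ (GC n) X}
  {ρ₂ : Representation ℂ (GC n) Y} {ρ₃ : Representation ℂ (GC n) Z} {a₁ a₂ a₃ : Weight n}

theorem apply_ne_zero {G : Type*} [Group G] (ρ : Representation ℂ G X) (g : G) {v : X}
    (hv : v ≠ 0) : ρ g v ≠ 0 := fun h0 => hv (by
  have := congrArg (ρ g⁻¹) h0
  rwa [← Module.End.mul_apply, ← map_mul, inv_mul_cancel, map_one, map_zero] at this)

theorem exists_twistedDiag_ne_zero_of_left [NeZero n] (h₁ : IsIrrepGC ρ₁ a₁)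
    (h₂ : IsIrrepGC ρ₂ a₂) (h₃ : IsIrrepGC ρ₃ a₃)
    (ha : ∀ i k : Fin n, i ≠ 0 → k ≠ 0 → a₃.left i = a₃.left k)
    {φ : X ⊗[ℂ] (Y ⊗[ℂ] Z) →ₗ[ℂ] ℂ}
    (hφ : ∀ g x y z, φ (ρ₁ g x ⊗ₜ (ρ₂ g y ⊗ₜ ρ₃ g z)) = φ (x ⊗ₜ (y ⊗ₜ z))) (hφ0 : φ ≠ 0)
    {x : X} {y : Y} {z : Z} (hx0 : x ≠ 0) (hy0 : y ≠ 0) (hz0 : z ≠ 0) (hx : IsExtremal ρ₁ a₁ x)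
    (hy : IsExtremal ρ₂ a₂ y) (hz : IsExtremal ρ₃ a₃ z) :
    ∃ g₁ g₂ g₃, φ (ρ₁ (twistedDiag n g₁) x ⊗ₜ
      (ρ₂ (twistedDiag n g₂) y ⊗ₜ ρ₃ (twistedDiag n g₃) z)) ≠ 0 := by
  have := h₃.finiteDimensional
  -- The Weyl element in the second slot makes the first two Borel subgroups opposite, as the open
  -- orbit requires.
  refine exists_twistedDiag_ne_zero h₁.algebraic h₂.algebraic h₃.algebraic φ hφ (γ₁ := 1)
    (γ₂ := weyl n) (γ₃ := 1) (fun b hb => ⟨borelChar a₁.left b, ?_⟩)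
    (fun l hl => ⟨borelChar a₂.left (weyl n * l * weyl n), ?_⟩) (fun p hp => ?_)
    (exists_tmul_orbit_ne_zero h₁.irreducible h₂.irreducible h₃.irreducible hx0 hy0 hz0 hφ0)
  · rw [Prod.mk_one_one, map_one, Module.End.one_apply]
    exact hx.left hb
  · have e : ((l, 1) * (weyl n, 1) : GC n) = (weyl n, 1) * (weyl n * l * weyl n, 1) := by
      refine Prod.ext ?_ rfl
      simp only [Prod.fst_mul, ← mul_assoc, weyl_mul_self, one_mul]
    rw [← Module.End.mul_apply, ← map_mul, e, map_mul, Module.End.mul_apply,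
      hy.left hl.weyl_conj, map_smul]
  · rw [Prod.mk_one_one, map_one, Module.End.one_apply]
    exact exists_eigenvalue_of_first_column
      (σ := ρ₃.comp (MonoidHom.inl (GLC n) (GLC n)))
      (fun v l => left_mem_regularGL (h₃.algebraic v l) 1) (fun b hb => hz.left hb) ha hp

theorem invTranspose_weyl : invTranspose (weyl n) = weyl n := by
  apply Units.ext
  rw [coe_invTranspose, weyl_inv]
  ext i j
  simp only [weyl, Matrix.transpose_apply, Matrix.of_apply]
  exact if_congr (Fin.rev_eq_iff.trans eq_comm) rfl rfl

/-- Interchanging the factors reduces to the left case, since it preserves the twisted diagonal: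
`(g, g⁻ᵗ)` becomes the element attached to `g⁻ᵗ`. -/
theorem exists_twistedDiag_ne_zero_of_right [NeZero n] (h₁ : IsIrrepGC ρ₁ a₁)
    (h₂ : IsIrrepGC ρ₂ a₂) (h₃ : IsIrrepGC ρ₃ a₃)
    (ha : ∀ i k : Fin n, i ≠ 0 → k ≠ 0 → a₃.right i = a₃.right k)
    {φ : X ⊗[ℂ] (Y ⊗[ℂ] Z) →ₗ[ℂ] ℂ}
    (hφ : ∀ g x y z, φ (ρ₁ g x ⊗ₜ (ρ₂ g y ⊗ₜ ρ₃ g z)) = φ (x ⊗ₜ (y ⊗ₜ z))) (hφ0 : φ ≠ 0)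
    {x : X} {y : Y} {z : Z} (hx0 : x ≠ 0) (hy0 : y ≠ 0) (hz0 : z ≠ 0) (hx : IsExtremal ρ₁ a₁ x)
    (hy : IsExtremal ρ₂ a₂ y) (hz : IsExtremal ρ₃ a₃ z) :
    ∃ g₁ g₂ g₃, φ (ρ₁ (twistedDiag n g₁) x ⊗ₜ
      (ρ₂ (twistedDiag n g₂) y ⊗ₜ ρ₃ (twistedDiag n g₃) z)) ≠ 0 := by
  let w : GC n := (weyl n, weyl n)
  obtain ⟨g₁, g₂, g₃, h⟩ := exists_twistedDiag_ne_zero_of_left h₁.swap h₂.swap h₃.swap ha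
    (fun g => hφ (swapGC n g)) hφ0 (apply_ne_zero ρ₁ w hx0) (apply_ne_zero ρ₂ w hy0)
    (apply_ne_zero ρ₃ w hz0) hx.swap hy.swap hz.swap
  have e : ∀ g, swapGC n (twistedDiag n g) * w = twistedDiag n (invTranspose g * weyl n) := by
    intro g
    refine Prod.ext rfl ?_
    change g * weyl n = invTranspose (invTranspose g * weyl n)
    rw [map_mul, invTranspose_invTranspose, invTranspose_weyl]
  refine ⟨invTranspose g₁ * weyl n, invTranspose g₂ * weyl n, invTranspose g₃ * weyl n, ?_⟩
  rw [← e, ← e, ← e, map_mul ρ₁, map_mul ρ₂, map_mul ρ₃]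
  exact h

end Nonvanishing

end RankinSelberg

end

/-! ### The main theorem -/

open RankinSelberg in
theorem mainTheorem8
    {𝕂 : Type*} [Field 𝕂] [TopologicalSpace 𝕂] (ι₁ ι₂ : 𝕂 ≃+* ℂ)
    (hι₁ : IsHomeomorph ι₁) (hι₂ : IsHomeomorph ι₂) (hι : ι₁ ≠ ι₂)
    (n : ℕ) (hn : 2 ≤ n)
    (μ ν : Weight n) (hμ : μ.IsDominant) (hν : ν.IsDominant)
    (w w' : ℤ) (hμw : μ.IsPure w) (hνw : ν.IsPure w')
    (hcompat : Compatible μ ν w w')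
    (j : ℤ) (hj : IsCriticalPlace μ ν w w' j)
    (lam : Weight n) (hlam : IsVWeight μ ν w w' j lam)
    {Fμ Fν V : Type*} [AddCommGroup Fμ] [Module ℂ Fμ] [AddCommGroup Fν] [Module ℂ Fν]
    [AddCommGroup V] [Module ℂ V]
    (ρμ : Representation ℂ (GC n) Fμ) (hρμ : IsIrrepGC ρμ μ)
    (ρν : Representation ℂ (GC n) Fν) (hρν : IsIrrepGC ρν ν)
    (ρV : Representation ℂ (GC n) V) (hρV : IsIrrepGC ρV lam)
    {Tμ Tν S : Type*} [AddCommGroup Tμ] [Module ℂ Tμ] [AddCommGroup Tν] [Module ℂ Tν]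
    [AddCommGroup S] [Module ℂ S]
    (τμ : Representation ℂ (unitaryK ι₁ ι₂ n) Tμ) (hτμ : IsKType ι₁ ι₂ τμ μ.toKWeight)
    (τν : Representation ℂ (unitaryK ι₁ ι₂ n) Tν) (hτν : IsKType ι₁ ι₂ τν ν.toKWeight)
    (σj : Representation ℂ (unitaryK ι₁ ι₂ n) S) (hσj : IsKType ι₁ ι₂ σj lam.toKWeight) :
    let Fξ := outerTensor ρμ.dual ρν.dual ρV
    let FξK := Fξ.comp (cube (kToGC ι₁ ι₂ n))
    let FξG := Fξ.comp (diag (GC n))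
    let τξ := outerTensor τμ.dual τν.dual σj
    τξ.IsIrreducible ∧
    Module.finrank ℂ (Representation.IntertwiningMap τξ FξK) = 1 ∧
    ∀ φ : Representation.IntertwiningMap FξG (Representation.trivial ℂ (GC n) ℂ), φ ≠ 0 →
      ∀ f : Representation.IntertwiningMap τξ FξK, f ≠ 0 →
        ∃ x, φ (f x) ≠ 0 := by
  intro Fξ FξK FξG τξ
  have : NeZero n := ⟨by omega⟩
  have hconj := isomorphism_eq_conj hι₁ hι₂ hι
  have hρμ' := hρμ.dual
  have hρν' := hρν.dual
  have hτμ' := hτμ.dual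
  have hτν' := hτν.dual
  have := hρμ'.finiteDimensional
  have := hρν'.finiteDimensional
  have := hρV.finiteDimensional
  have fd₁ := hτμ.choose_spec.1.finiteDimensional
  have fd₂ := hτν.choose_spec.1.finiteDimensional
  have fd₃ := hσj.choose_spec.1.finiteDimensional
  obtain ⟨f₁, s₁, x₁, hx₁0, hx₁, hs₁, hf₁, hu₁⟩ := hτμ'.exists_embedding hconj hρμ'
  obtain ⟨f₂, s₂, x₂, hx₂0, hx₂, hs₂, hf₂, hu₂⟩ := hτν'.exists_embedding hconj hρν'
  obtain ⟨f₃, s₃, x₃, hx₃0, hx₃, hs₃, hf₃, hu₃⟩ := hσj.exists_embedding hconj hρV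
  have hf₁0 : f₁ (s₁ 1) ≠ 0 := by rwa [hs₁, map_one, map_one, Module.End.one_apply]
  have hf₂0 : f₂ (s₂ 1) ≠ 0 := by rwa [hs₂, map_one, map_one, Module.End.one_apply]
  have hf₃0 : f₃ (s₃ 1) ≠ 0 := by rwa [hs₃, map_one, map_one, Module.End.one_apply]
  let f₀ : Representation.IntertwiningMap τξ FξK :=
    ⟨TensorProduct.map f₁ (TensorProduct.map f₂ f₃), fun k => by
      refine TensorProduct.ext' fun x y => ?_
      induction y with
      | zero => simp
      | tmul y z =>
        change f₁ (τμ.dual k.1 x) ⊗ₜ (f₂ (τν.dual k.2.1 y) ⊗ₜ f₃ (σj k.2.2 z)) =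
          ρμ.dual (kToGC ι₁ ι₂ n k.1) (f₁ x) ⊗ₜ (ρν.dual (kToGC ι₁ ι₂ n k.2.1) (f₂ y) ⊗ₜ
            ρV (kToGC ι₁ ι₂ n k.2.2) (f₃ z))
        rw [hf₁, hf₂, hf₃]
      | add y z hy hz => rw [TensorProduct.tmul_add, map_add, map_add, hy, hz]⟩
  have hf₀0 : f₀ ≠ 0 := fun h => by
    have := congrArg (fun f : Representation.IntertwiningMap τξ FξK =>
      f (s₁ 1 ⊗ₜ (s₂ 1 ⊗ₜ s₃ 1))) h
    exact tmul_ne_zero_of_ne_zero hf₁0 (tmul_ne_zero_of_ne_zero hf₂0 hf₃0) this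
  have hmap₁ : ∀ k, τξ (k, 1, 1) = TensorProduct.map (τμ.dual k) LinearMap.id := fun k => by
    change TensorProduct.map (τμ.dual k) (TensorProduct.map (τν.dual 1) (σj 1)) = _
    rw [map_one, map_one]
    exact congrArg _ TensorProduct.map_id
  have hmap₁' : ∀ k, FξK (k, 1, 1) =
      TensorProduct.map (ρμ.dual (kToGC ι₁ ι₂ n k)) LinearMap.id := fun k => by
    change TensorProduct.map (ρμ.dual (kToGC ι₁ ι₂ n k))
      (TensorProduct.map (ρν.dual (kToGC ι₁ ι₂ n 1)) (ρV (kToGC ι₁ ι₂ n 1))) = _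
    rw [map_one, map_one, map_one]
    exact congrArg _ TensorProduct.map_id
  have hmap₂ : ∀ k : unitaryK ι₁ ι₂ n × unitaryK ι₁ ι₂ n, τξ (1, k) =
      TensorProduct.map LinearMap.id (TensorProduct.map (τν.dual k.1) (σj k.2)) := fun k => by
    change TensorProduct.map (τμ.dual 1) _ = _
    rw [map_one]
    rfl
  have hmap₂' : ∀ k : unitaryK ι₁ ι₂ n × unitaryK ι₁ ι₂ n, FξK (1, k) = TensorProduct.map
      LinearMap.id (TensorProduct.map (ρν.dual (kToGC ι₁ ι₂ n k.1)) (ρV (kToGC ι₁ ι₂ n k.2))) :=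
    fun k => by
    change TensorProduct.map (ρμ.dual (kToGC ι₁ ι₂ n 1)) _ = _
    rw [map_one, map_one]
    rfl
  -- The first two tensor factors are split off in turn, each by multiplicity one; what remains is
  -- an equivariant map on the third.
  have huniq : ∀ f : Representation.IntertwiningMap τξ FξK, ∃ c : ℂ, c • f₀ = f := by
    intro f
    obtain ⟨F', hF', hF'e⟩ := exists_tensor_factor hf₁0 hu₁ f.toLinearMap (fun k z => by
      rw [← hmap₁ k, ← hmap₁' k]
      exact Representation.IntertwiningMap.isIntertwining _ _ f _ _) (fun k z => by
      rw [← hmap₂ k, ← hmap₂' k]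
      exact Representation.IntertwiningMap.isIntertwining _ _ f _ _)
    obtain ⟨F'', hF'', hF''e⟩ := exists_tensor_factor hf₂0 hu₂ F' (fun k z => by
      have : F' (TensorProduct.map (τν.dual k) (σj 1) z) = TensorProduct.map
        (ρν.dual (kToGC ι₁ ι₂ n k)) (ρV (kToGC ι₁ ι₂ n 1)) (F' z) := hF'e (k, 1) z
      rwa [map_one, map_one, map_one] at this)
      (b := fun k => σj k) (b' := fun k => ρV (kToGC ι₁ ι₂ n k)) (fun k z => by
      have : F' (TensorProduct.map (τν.dual 1) (σj k) z) = TensorProduct.map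
        (ρν.dual (kToGC ι₁ ι₂ n 1)) (ρV (kToGC ι₁ ι₂ n k)) (F' z) := hF'e (1, k) z
      rwa [map_one, map_one, map_one] at this)
    obtain ⟨c, hc⟩ := hu₃ F'' hF''e
    refine ⟨c, Representation.IntertwiningMap.ext ?_⟩
    rw [hF', hF'', hc, TensorProduct.map_smul_right, TensorProduct.map_smul_right]
    rfl
  refine ⟨?_, ?_, fun φ hφ f hf => ?_⟩
  · have h₂₃ : Representation.IsIrreducible (Representation.tprod
        (τν.dual.comp (MonoidHom.fst (unitaryK ι₁ ι₂ n) (unitaryK ι₁ ι₂ n)))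
        (σj.comp (MonoidHom.snd (unitaryK ι₁ ι₂ n) (unitaryK ι₁ ι₂ n)))) := by
      refine isIrreducible_tensor (hτν'.isIrreducible hconj) (hσj.isIrreducible hconj) _
        (fun k => ⟨(k, 1), ?_⟩) (fun k => ⟨(1, k), ?_⟩)
      · change TensorProduct.map (τν.dual k) (σj 1) = _
        rw [map_one]
        rfl
      · change TensorProduct.map (τν.dual 1) (σj k) = _
        rw [map_one]
        rfl
    exact isIrreducible_tensor (hτμ'.isIrreducible hconj) h₂₃ τξ (fun k => ⟨_, hmap₁ k⟩)
      (fun k => ⟨_, hmap₂ k⟩)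
  · rw [← LinearEquiv.finrank_eq (LinearEquiv.ofBijective (LinearMap.toSpanSingleton ℂ _ f₀)
      ⟨fun c d hcd => ?_, huniq⟩), Module.finrank_self]
    have := congrArg (fun f : Representation.IntertwiningMap τξ FξK =>
      f (s₁ 1 ⊗ₜ (s₂ 1 ⊗ₜ s₃ 1))) hcd
    exact smul_left_injective ℂ
      (tmul_ne_zero_of_ne_zero hf₁0 (tmul_ne_zero_of_ne_zero hf₂0 hf₃0)) this
  · obtain ⟨c, rfl⟩ := huniq f
    have hc : c ≠ 0 := by
      rintro rfl
      exact hf (zero_smul _ _)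
    have hinv : ∀ g x y z, φ.toLinearMap (ρμ.dual g x ⊗ₜ (ρν.dual g y ⊗ₜ ρV g z)) =
        φ.toLinearMap (x ⊗ₜ (y ⊗ₜ z)) := fun g x y z =>
      Representation.IntertwiningMap.isIntertwining _ _ φ g (x ⊗ₜ (y ⊗ₜ z))
    have hφ0 : φ.toLinearMap ≠ 0 := fun h => hφ (Representation.IntertwiningMap.ext h)
    obtain ⟨g₁, g₂, g₃, hg⟩ := hlam.almost_const.elim
      (fun ha => exists_twistedDiag_ne_zero_of_left hρμ' hρν' hρV ha hinv hφ0 hx₁0 hx₂0 hx₃0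
        hx₁ hx₂ hx₃)
      (fun ha => exists_twistedDiag_ne_zero_of_right hρμ' hρν' hρV ha hinv hφ0 hx₁0 hx₂0 hx₃0
        hx₁ hx₂ hx₃)
    -- Each `s_i g_i` is a preimage in the `K`-type of the translate of the extremal vector by the
    -- twisted diagonal element of `g_i`.
    refine ⟨s₁ g₁ ⊗ₜ (s₂ g₂ ⊗ₜ s₃ g₃), ?_⟩
    have e : (c • f₀) (s₁ g₁ ⊗ₜ (s₂ g₂ ⊗ₜ s₃ g₃)) = c • (f₁ (s₁ g₁) ⊗ₜ (f₂ (s₂ g₂) ⊗ₜ f₃ (s₃ g₃))) :=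
      rfl
    rw [e, hs₁, hs₂, hs₃, map_smul]
    exact smul_ne_zero hc hg
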